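/- **Setting.** Let $S$ be a countable set, $\Xi$ a complete separable metric space, $h: S\times\Xi\to S$ measurable, and $\xi=(\xi_t)_{t\in\mathbb Z}$ a stationary and ergodic sequence of random elements of $\Xi$ on a probability space $(\Omega,\mathcal F,\mathbf P)$. Define the follow map $f_+(t,y)=(t+1,h(y,\xi_t))$ on $\mathbb Z\times S$. Fix a state $x^*\in S$ that is positive recurrent, i.e. $\mathbf E[\inf\{n\ge 1: f_+^n(0,x^*)\in\mathbb Z\times\{x^*\}\}]<\infty$. The bridge graph $\mathbf B$ has vertex set $V(\mathbf B)=\{f_+^n(t,x^*):t\in\mathbb Z,\,n\ge0\}$ and an edge from each vertex $v$ to $f_+(v)$; $\overline{\mathbf B}$ is $\mathbf B$ with the spine added, i.e. with additional edges from $(t,x^*)$ to $(t+1,x^*)$ for all $t\in\mathbb Z$. For finite $I\subseteq\mathbb Z$ let $V_I(\mathbf B)=\{(t,y)\in V(\mathbf B):t\in I\}$, $V_0(\mathbf B)=V_{\{0\}}(\mathbf B)$, $\#\mathbf B_0=\#V_0(\mathbf B)$, and let $\overline{\mathbf B}\cap I$ be the subgraph of $\overline{\mathbf B}$ induced by $V_I(\mathbf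 B)$. Let $\mathcal G_*$ be the space of isomorphism classes $[\Gamma,o]$ of locally finite connected rooted networks (graphs with a mark for every vertex $v$ and every incident pair $(v,e)$) with marks in a fixed complete separable metric space $M$ into which $S\times\Xi$ ($S$ discrete) is topologically embedded, and into which $\{0,1\}$ is injectively mapped. Give it the distance $1/(1+\alpha)$, where $\alpha$ is the supremum of the $r>0$ such that there is a rooted isomorphism of the balls of radius $\lfloor r\rfloor$ around the roots with corresponding marks at distance less than $1/r$, and the Borel $\sigma$-algebra. View $\overline{\mathbf B}$ and its subgraphs as networks: the vertex $(t,y)$ is marked by $(y,\xi_t)$, and the mark of $(v,e)$ tells whether $e$ is directed (forwards in time) out of $v$. If a graph $\Gamma$ is not connected, $[\Gamma,v]$ means the connected component of $v$ rooted at $v$. Set $$\mathbf P^{\square}(A)=\frac1{\mathbf E[\#\mathbf B_0]}\,\mathbf E\Big[\sum_{w\in V_0(\mathbf B)}1_{\{[\overline{\mathbf B},w]\in A\}}\Big],\qquad A\in\mathcal B(\mathcal G_*),$$ and write $\mathbf E^\square$ for the integral with respect to $\mathbf P^\square$. **Proposition.** Let $(I_n)_{n\in\mathbb N}$ be a strictly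 increasing sequence of finite intervals of $\mathbb Z$. Then $\mathbf P^\square$ is a probability measure, almost surely all $V_{I_n}(\mathbf B)$ are finite, and the following hold. 1. For every bounded measurable $g:\mathcal G_*\to\mathbb R_{\ge0}$ that depends only on the neighbourhood of some fixed radius $N$ around the root, $$\frac1{\#V_{I_n}(\mathbf B)}\sum_{v\in V_{I_n}(\mathbf B)}g[\overline{\mathbf B}\cap I_n,v]\;\longrightarrow\;\mathbf E^{\square}[g]\qquad\mathbf P\text{-a.s. as }n\to\infty.$$ 2. If for each $n$ the random vertex $\boldsymbol o_n$ is, conditionally on $V_{I_n}(\mathbf B)$, uniformly distributed on $V_{I_n}(\mathbf B)$ and independent of $\overline{\mathbf B}\cap I_n$ (including its marks), then each $[\overline{\mathbf B}\cap I_n,\boldsymbol o_n]$ is ($\mathbf P$-a.e.) measurable and $$\mathbf P([\overline{\mathbf B}\cap I_n,\boldsymbol o_n]\in\cdot)\;\longrightarrow\;\mathbf P^{\square},\qquad n\to\infty,$$ in the sense of local weak convergence, i.e. weakly as probability measures on $\mathcal G_*$. -/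

import Mathlib

open MeasureTheory Filter Topology
open scoped ENNReal NNReal

namespace Doeblin

universe u v w

/-! Marked rooted networks and the space of their isomorphism classes -/

/-- A nonempty, locally finite, connected rooted network with marks in `M`.  The mark of the
pair `(a, {a, b})` is `emark a b`; only its values at adjacent `a`, `b` matter. -/
structure RootedNetwork (M : Type v) : Type (max (u + 1) v) where
  V : Type u
  graph : SimpleGraph V
  vmark : V → M
  emark : V → V → M
  root : V
  connected : graph.Connected
  locallyFinite : ∀ a, (graph.neighborSet a).Finite

namespace RootedNetwork

variable {M : Type v}

/-- Rooted isomorphism: a graph isomorphism preserving the root and all marks. -/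
def Iso (A B : RootedNetwork.{u} M) : Prop :=
  ∃ φ : A.graph ≃g B.graph, φ A.root = B.root ∧
    (∀ a, B.vmark (φ a) = A.vmark a) ∧
    ∀ a b, A.graph.Adj a b → B.emark (φ a) (φ b) = A.emark a b

theorem Iso.refl (A : RootedNetwork.{u} M) : Iso A A :=
  ⟨SimpleGraph.Iso.refl, rfl, fun _ => rfl, fun _ _ _ => rfl⟩

theorem Iso.symm {A B : RootedNetwork.{u} M} : Iso A B → Iso B A := by
  rintro ⟨φ, hr, hv, he⟩
  refine ⟨φ.symm, by rw [← hr]; simp, fun a => ?_, fun a b hab => ?_⟩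
  · rw [← hv]; simp
  · rw [← he _ _ (φ.symm.map_adj_iff.2 hab)]; simp

theorem Iso.trans {A B C : RootedNetwork.{u} M} : Iso A B → Iso B C → Iso A C := by
  rintro ⟨φ, hr, hv, he⟩ ⟨ψ, hr', hv', he'⟩
  refine ⟨φ.trans ψ, ?_, fun a => ?_, fun a b hab => ?_⟩
  · simp [hr, hr']
  · simp [hv, hv']
  · simp [he' _ _ (φ.map_adj_iff.2 hab), he _ _ hab]

/-- Rooted networks up to rooted isomorphism. -/
instance setoid (M : Type v) : Setoid (RootedNetwork.{u} M) :=
  ⟨Iso, Iso.refl, Iso.symm, Iso.trans⟩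

/-- The ball of graph distance `n` around the root. -/
def ball (A : RootedNetwork.{u} M) (n : ℕ) : Set A.V := {a | A.graph.dist A.root a ≤ n}

/-- There is a rooted graph isomorphism between the balls of radius `n` around the roots, such
that each pair of corresponding marks is in the relation `R`. -/
def BallIso (R : M → M → Prop) (n : ℕ) (A B : RootedNetwork.{u} M) : Prop :=
  ∃ φ : A.graph.induce (A.ball n) ≃g B.graph.induce (B.ball n),
    (∀ a : A.ball n, (a : A.V) = A.root → (φ a : B.V) = B.root) ∧
    (∀ a : A.ball n, R (A.vmark a) (B.vmark (φ a))) ∧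
    ∀ a b : A.ball n, A.graph.Adj a b → R (A.emark a b) (B.emark (φ a) (φ b))

end RootedNetwork

/-- The set of isomorphism classes of nonempty, locally finite, connected rooted networks with
marks in `M`. -/
def GStar (M : Type v) : Type (max (u + 1) v) := Quotient (RootedNetwork.setoid.{u} M)

namespace GStar

/-- The isomorphism class `[Γ, o]`. -/
def mk {M : Type v} (A : RootedNetwork.{u} M) : GStar.{u} M := Quotient.mk _ A

/-- `BallIso` for isomorphism classes. -/
def BallIso {M : Type v} (R : M → M → Prop) (n : ℕ) (x y : GStar.{u} M) : Prop :=
  ∃ A B : RootedNetwork.{u} M, mk A = x ∧ mk B = y ∧ A.BallIso R n B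

/-- The supremum `α ∈ [0, ∞]` of those `r > 0` such that the balls of radius `⌊r⌋` around the
roots are isomorphic with corresponding marks at distance less than `1 / r`. -/
noncomputable def agreement {M : Type v} [MetricSpace M] (x y : GStar.{u} M) : ℝ≥0∞ :=
  ⨆ (r : ℝ≥0) (_ : 0 < r ∧ BallIso (fun a b : M => dist a b < 1 / (r : ℝ)) ⌊r⌋₊ x y), (r : ℝ≥0∞)

/-- The distance `1 / (1 + α)`. -/
noncomputable def netDist {M : Type v} [MetricSpace M] (x y : GStar.{u} M) : ℝ :=
  ((1 + agreement x y)⁻¹).toReal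

/-- The topology of the distance `netDist`. -/
instance {M : Type v} [MetricSpace M] : TopologicalSpace (GStar.{u} M) where
  IsOpen U := ∀ x ∈ U, ∃ ε > 0, ∀ y, netDist x y < ε → y ∈ U
  isOpen_univ := fun _ _ => ⟨1, one_pos, fun _ _ => trivial⟩
  isOpen_inter := by
    rintro U U' hU hU' x ⟨hx, hx'⟩
    obtain ⟨ε, hε, h⟩ := hU x hx
    obtain ⟨ε', hε', h'⟩ := hU' x hx'
    exact ⟨min ε ε', lt_min hε hε', fun y hy =>
      ⟨h y (hy.trans_le (min_le_left _ _)), h' y (hy.trans_le (min_le_right _ _))⟩⟩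
  isOpen_sUnion := by
    rintro 𝒰 h𝒰 x ⟨U, hU, hx⟩
    obtain ⟨ε, hε, h⟩ := h𝒰 U hU x hx
    exact ⟨ε, hε, fun y hy => ⟨U, hU, h y hy⟩⟩

instance {M : Type v} [MetricSpace M] : MeasurableSpace (GStar.{u} M) := borel _

instance {M : Type v} [MetricSpace M] : BorelSpace (GStar.{u} M) := ⟨rfl⟩

/-- `g` depends only on the (marked) neighbourhood of some fixed radius around the root. -/
def IsLocal {M : Type v} {β : Type w} (g : GStar.{u} M → β) : Prop :=
  ∃ N : ℕ, ∀ x y : GStar.{u} M, BallIso (fun a b : M => a = b) N x y → g x = g y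

/-- The class of the connected component of `o` in a graph on a fixed vertex set `W`, rooted at
`o` and with the given marks.  Where the graph fails to be locally finite (which has probability
zero in all uses below) the value is, by convention, the one-vertex network. -/
noncomputable def ofGraph {W : Type u} {M : Type v} (G : SimpleGraph W) (vm : W → M)
    (em : W → W → M) (o : W) : GStar.{u} M :=
  open Classical in
  if h : ∀ a, (G.neighborSet a).Finite then
    mk { V := (G.connectedComponentMk o).supp
         graph := G.induce (G.connectedComponentMk o).supp
         vmark := fun a => vm a
         emark := fun a b => em a b
         root := ⟨o, rfl⟩
         connected := (G.connectedComponentMk o).connected_toSimpleGraph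
         locallyFinite := fun a =>
           ((h a).preimage Subtype.val_injective.injOn).subset fun _ hb => hb }
  else
    mk { V := PUnit
         graph := ⊥
         vmark := fun _ => vm o
         emark := fun _ _ => vm o
         root := PUnit.unit
         connected := SimpleGraph.connected_iff_exists_forall_reachable _ |>.2
           ⟨PUnit.unit, fun _ => SimpleGraph.Reachable.refl _⟩
         locallyFinite := fun _ => Set.toFinite _ }

end GStar

/-! The Doeblin graph and the bridge graph, for a realization `x : ℤ → Ξ` of the driving sequence -/

section Graph

variable {S : Type u} {Ξ : Type w}

/-- The shift of sequences indexed by `ℤ`. -/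
def shift (x : ℤ → Ξ) : ℤ → Ξ := fun t => x (t + 1)

/-- The follow map `(t, y) ↦ (t + 1, h (y, x t))`. -/
def follow (h : S × Ξ → S) (x : ℤ → Ξ) (a : ℤ × S) : ℤ × S := (a.1 + 1, h (a.2, x a.1))

/-- The time until the path started at time `t` in state `y` returns to state `z`:
the infimum of those `n > 0` such that the path is in state `z` at time `t + n`. -/
noncomputable def timeUntilReturn (h : S × Ξ → S) (x : ℤ → Ξ) (t : ℤ) (y z : S) : ℝ≥0∞ :=
  ⨅ (n : ℕ) (_ : 0 < n ∧ ((follow h x)^[n] (t, y)).2 = z), (n : ℝ≥0∞)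

/-- The vertices of the bridge graph for state `s`: all vertices of the Doeblin graph on paths
started in state `s` at any time. -/
def bridgeVerts (h : S × Ξ → S) (s : S) (x : ℤ → Ξ) : Set (ℤ × S) :=
  {a | ∃ (t : ℤ) (n : ℕ), (follow h x)^[n] (t, s) = a}

/-- The vertices of the bridge graph at times in `I`. -/
def windowVerts (h : S × Ξ → S) (s : S) (x : ℤ → Ξ) (I : Finset ℤ) : Set (ℤ × S) :=
  {a | a ∈ bridgeVerts h s x ∧ a.1 ∈ I}

/-- There is a directed edge from `a` to `b` either because `b` follows `a` in the Doeblin graph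
or because it belongs to the spine. -/
def Arrow (h : S × Ξ → S) (s : S) (x : ℤ → Ξ) (a b : ℤ × S) : Prop :=
  b = follow h x a ∨ (a.2 = s ∧ b = (a.1 + 1, s))

theorem Arrow.time {h : S × Ξ → S} {s : S} {x : ℤ → Ξ} {a b : ℤ × S} :
    Arrow h s x a b → b.1 = a.1 + 1 := by
  rintro (rfl | ⟨_, rfl⟩) <;> rfl

/-- The bridge graph with spine added, as an undirected graph on `ℤ × S` (vertices that do not
belong to the bridge graph are isolated; the directions are recorded by marks). -/
def spineGraph (h : S × Ξ → S) (s : S) (x : ℤ → Ξ) : SimpleGraph (ℤ × S) where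
  Adj a b := a ∈ bridgeVerts h s x ∧ b ∈ bridgeVerts h s x ∧ (Arrow h s x a b ∨ Arrow h s x b a)
  symm := ⟨fun _ _ hab => ⟨hab.2.1, hab.1, hab.2.2.symm⟩⟩
  loopless := ⟨fun a ha => by
    rcases ha.2.2 with h | h <;> · have := h.time; omega⟩

/-- The subgraph of the bridge graph with spine induced by its vertices at times in `I`. -/
def windowGraph (h : S × Ξ → S) (s : S) (x : ℤ → Ξ) (I : Finset ℤ) : SimpleGraph (ℤ × S) where
  Adj a b := (spineGraph h s x).Adj a b ∧ a.1 ∈ I ∧ b.1 ∈ I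
  symm := ⟨fun _ _ hab => ⟨hab.1.symm, hab.2.2, hab.2.1⟩⟩
  loopless := ⟨fun a ha => (spineGraph h s x).loopless.irrefl a ha.1⟩

variable {M : Type v}

/-- The vertex `(t, y)` is marked by `(y, x t)`, embedded in the mark space. -/
def vertexMark (mV : S × Ξ → M) (x : ℤ → Ξ) (a : ℤ × S) : M := mV (a.2, x a.1)

/-- The mark of `(a, {a, b})` tells whether the edge is directed from `a` to `b`, that is,
forwards in time. -/
def edgeMark (mE : Bool → M) (a b : ℤ × S) : M := mE (decide (b.1 = a.1 + 1))

/-- The bridge graph with spine, rooted at `o`. -/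
noncomputable def bridgeClass (h : S × Ξ → S) (s : S) (mV : S × Ξ → M) (mE : Bool → M)
    (x : ℤ → Ξ) (o : ℤ × S) : GStar.{u} M :=
  GStar.ofGraph (spineGraph h s x) (vertexMark mV x) (edgeMark mE) o

/-- The bridge graph with spine restricted to the time window `I`, rooted at `o` (more precisely,
the component of the root). -/
noncomputable def windowClass (h : S × Ξ → S) (s : S) (mV : S × Ξ → M) (mE : Bool → M)
    (x : ℤ → Ξ) (I : Finset ℤ) (o : ℤ × S) : GStar.{u} M :=
  GStar.ofGraph (windowGraph h s x I) (vertexMark mV x) (edgeMark mE) o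

end Graph

/-! The random objects -/

section Random

variable {Ω : Type*} {S : Type u} {Ξ : Type w} {M : Type v}

/-- The realization of the driving sequence at `ω`. -/
def path (ξ : ℤ → Ω → Ξ) (ω : Ω) : ℤ → Ξ := fun t => ξ t ω

variable [MeasurableSpace Ω]

/-- The driving sequence is stationary and ergodic. -/
def IsStationaryErgodic [MeasurableSpace Ξ] (P : Measure Ω) (ξ : ℤ → Ω → Ξ) : Prop :=
  Ergodic (shift : (ℤ → Ξ) → ℤ → Ξ) (P.map (path ξ))

/-- The state `s` is positive recurrent: the expected return time to `s` is finite. -/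
def IsPositiveRecurrent (P : Measure Ω) (ξ : ℤ → Ω → Ξ) (h : S × Ξ → S) (s : S) : Prop :=
  ∫⁻ ω, timeUntilReturn h (path ξ ω) 0 s s ∂P < ∞

/-- The expected number of vertices of the bridge graph at time `0`. -/
noncomputable def meanSlice (P : Measure Ω) (ξ : ℤ → Ω → Ξ) (h : S × Ξ → S) (s : S) : ℝ≥0∞ :=
  ∫⁻ ω, ((windowVerts h s (path ξ ω) {0}).encard : ℝ≥0∞) ∂P

/-- The measure `A ↦ E[∑ 1{[B̄, w] ∈ A}] / E[#B₀]`, the sum over the vertices `w` of the bridge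
graph at time `0`. -/
noncomputable def unimodularMeasure [MetricSpace M] (P : Measure Ω) (ξ : ℤ → Ω → Ξ)
    (h : S × Ξ → S) (s : S) (mV : S × Ξ → M) (mE : Bool → M) : Measure (GStar.{u} M) :=
  (meanSlice P ξ h s)⁻¹ • P.bind fun ω =>
    Measure.sum fun w : windowVerts h s (path ξ ω) {0} =>
      Measure.dirac (bridgeClass h s mV mE (path ξ ω) w)

/-- The σ-algebra on `Ω` generated by the bridge graph with spine restricted to `I`, including
its marks: it tells which vertices and edges are present and what their marks are. -/
@[reducible] def windowSigma [MeasurableSpace M] (ξ : ℤ → Ω → Ξ) (h : S × Ξ → S) (s : S) (mV : S × Ξ → M)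
    (mE : Bool → M) (I : Finset ℤ) : MeasurableSpace Ω :=
  MeasurableSpace.generateFrom
    ({E | ∃ (a : ℤ × S) (A : Set M), MeasurableSet A ∧
        E = {ω | a ∈ windowVerts h s (path ξ ω) I ∧ vertexMark mV (path ξ ω) a ∈ A}} ∪
     {E | ∃ (a b : ℤ × S) (A : Set M), MeasurableSet A ∧
        E = {ω | (windowGraph h s (path ξ ω) I).Adj a b ∧ edgeMark mE a b ∈ A}})

/-- The random vertex `o` is, conditionally on the vertices of the bridge graph in the window `I`,
uniformly distributed on them and independent of the (marked) restriction of the bridge graph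
with spine to `I`.  That is, conditionally on this marked restriction, `o` is equal to `a` with
probability `1 / #V` if `a` is one of its vertices, and with probability `0` otherwise. -/
def IsUniformRoot [MeasurableSpace S] [MeasurableSpace M] (P : Measure Ω) (ξ : ℤ → Ω → Ξ)
    (h : S × Ξ → S) (s : S) (mV : S × Ξ → M) (mE : Bool → M) (I : Finset ℤ)
    (o : Ω → ℤ × S) : Prop :=
  Measurable o ∧ ∀ (a : ℤ × S) (E : Set Ω), MeasurableSet[windowSigma ξ h s mV mE I] E →
    P (o ⁻¹' {a} ∩ E) =
      ∫⁻ ω in E, (windowVerts h s (path ξ ω) I).indicator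
        (fun _ => ((windowVerts h s (path ξ ω) I).encard : ℝ≥0∞)⁻¹) a ∂P

/-- Weak convergence of the laws of random networks, i.e. local weak convergence. -/
def LocalWeakTendsto [MetricSpace M] (P : Measure Ω) (X : ℕ → Ω → GStar.{u} M)
    (μ : Measure (GStar.{u} M)) : Prop :=
  (∀ n, AEMeasurable (X n) P) ∧
  ∃ (hX : ∀ n, IsProbabilityMeasure (P.map (X n))) (hμ : IsProbabilityMeasure μ),
    Tendsto (β := ProbabilityMeasure (GStar.{u} M)) (fun n => ⟨P.map (X n), hX n⟩) atTop
      (𝓝 ⟨μ, hμ⟩)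

end Random

end Doeblin

/-! Everything rests on the ergodic theorem for sums over time slices. The bridge graph of a
sequence `x`, seen from time `t`, is the bridge graph of the shifted sequence seen from time 0, and
no mark records absolute time (`bridgeClass_translate`). So the sum of `g` over the roots in slice
`t` is a fixed function, `sliceSum`, evaluated along the shift orbit of `x`. Averaging it over long
intervals, and doing the same for `g = 1`, gives a quotient that tends to E[sum of `g` over slice 0]
/ E[size of slice 0], which is the integral of `g` against `unimodularMeasure`.

Integrability comes from positive recurrence. A vertex at time 0 is determined by the last time -n
at which some path through it was in `s`, and from then on that path avoids `s` for n steps. By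
stationarity the expected number of such n is at most the sum of P(return time > n), that is, the
expected return time (`lintegral_encard_windowVerts_le`).

Cutting the graph to a window changes the `N`-ball of a root only within `N + 1` slices of an end of
the window. Slices are not bounded in size, but the window shrunk by `N + 1` at both ends has the
same asymptotic number of vertices per unit of length, so the boundary is negligible
(`HasMean.tendsto_shrink`, `tendsto_average`). The windows need not exhaust the integers; it is
enough that they share a point and grow in length.

For a uniform root, the expectation of `g` at the root is the expectation of the window average
(`integral_windowClass_root`), so dominated convergence applies. Bounded Lipschitz functions
determine weak convergence, and they are uniform limits of local functions because equal balls of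
radius `N` force distance at most 1/(1 + N). The window averages are therefore treated for the wider
class `IsAlmostLocal`. -/

namespace Doeblin

universe u v w

/-! ### Neighbourhoods by number of steps -/

section Neighbourhood

variable {V : Type*} {G G' : SimpleGraph V} {o : V}

/-- The vertices that can be reached from `o` in at most `n` steps. -/
def nbhd (G : SimpleGraph V) (o : V) : ℕ → Set V
  | 0 => {o}
  | n + 1 => {b | ∃ a ∈ nbhd G o n, a = b ∨ G.Adj a b}

theorem nbhd_subset_succ (G : SimpleGraph V) (o : V) (n : ℕ) : nbhd G o n ⊆ nbhd G o (n + 1) :=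
  fun a ha => ⟨a, ha, Or.inl rfl⟩

theorem nbhd_mono (G : SimpleGraph V) (o : V) : Monotone (nbhd G o) :=
  monotone_nat_of_le_succ (nbhd_subset_succ G o)

theorem mem_nbhd_self (G : SimpleGraph V) (o : V) (n : ℕ) : o ∈ nbhd G o n :=
  nbhd_mono G o (Nat.zero_le n) rfl

theorem finite_nbhd (hG : ∀ a, (G.neighborSet a).Finite) (o : V) (n : ℕ) :
    (nbhd G o n).Finite := by
  induction n with
  | zero => exact Set.finite_singleton o
  | succ n ih =>
    refine (ih.biUnion fun a _ => (Set.finite_singleton a).union (hG a)).subset ?_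
    rintro b ⟨a, ha, rfl | hab⟩
    · exact Set.mem_biUnion ha (Or.inl rfl)
    · exact Set.mem_biUnion ha (Or.inr hab)

theorem reachable_of_mem_nbhd {n : ℕ} {b : V} (hb : b ∈ nbhd G o n) : G.Reachable o b := by
  induction n generalizing b with
  | zero => exact hb ▸ SimpleGraph.Reachable.refl _
  | succ n ih =>
    obtain ⟨a, ha, rfl | hab⟩ := hb
    · exact ih ha
    · exact (ih ha).trans hab.reachable

theorem mem_nbhd_iff_dist_le (hG : G.Connected) {n : ℕ} {b : V} :
    b ∈ nbhd G o n ↔ G.dist o b ≤ n := by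
  constructor
  · intro hb
    induction n generalizing b with
    | zero => rw [show b = o from hb]; simp
    | succ n ih =>
      obtain ⟨a, ha, rfl | hab⟩ := hb
      · exact (ih ha).trans (Nat.le_succ n)
      · refine (hG.dist_triangle (v := a)).trans ?_
        rw [SimpleGraph.dist_eq_one_iff_adj.2 hab]
        exact Nat.succ_le_succ (ih ha)
  · intro hb
    obtain ⟨p, hp⟩ := hG.exists_walk_length_eq_dist o b
    rw [← hp] at hb
    clear hp
    induction n generalizing b with
    | zero =>
      have := p.eq_of_length_eq_zero (Nat.le_zero.1 hb)
      exact this.symm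
    | succ n ih =>
      induction p using SimpleGraph.Walk.concatRec with
      | Hnil => exact mem_nbhd_self _ _ _
      | Hconcat p hab _ =>
        rw [SimpleGraph.Walk.length_concat] at hb
        exact ⟨_, ih p (Nat.le_of_succ_le_succ hb), Or.inr hab⟩

/-- A new step only consults adjacency at vertices already reached, so agreement within `n` steps
settles one radius more. -/
theorem nbhd_congr {n : ℕ} (hn : ∀ a ∈ nbhd G o n, ∀ b, G.Adj a b ↔ G'.Adj a b) :
    ∀ k ≤ n + 1, nbhd G' o k = nbhd G o k := by
  intro k hk
  induction k with
  | zero => rfl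
  | succ k ih =>
    ext b
    simp only [nbhd, Set.mem_ofPred_eq, ih (by omega)]
    refine exists_congr fun a => and_congr_right fun ha => or_congr_right ?_
    exact (hn a (nbhd_mono G o (by omega) ha) b).symm

theorem coe_mem_nbhd_iff (n : ℕ) (b : (G.connectedComponentMk o).supp) :
    b ∈ nbhd (G.induce (G.connectedComponentMk o).supp) ⟨o, rfl⟩ n ↔ (b : V) ∈ nbhd G o n := by
  induction n generalizing b with
  | zero => exact Subtype.ext_iff
  | succ n ih =>
    constructor
    · rintro ⟨a, ha, hab⟩
      exact ⟨a, (ih a).1 ha, hab.imp (congrArg _) id⟩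
    · rintro ⟨a, ha, hab⟩
      have : a ∈ (G.connectedComponentMk o).supp :=
        SimpleGraph.ConnectedComponent.eq.2 (reachable_of_mem_nbhd ha).symm
      exact ⟨⟨a, this⟩, (ih ⟨a, this⟩).2 ha, hab.imp Subtype.ext id⟩

end Neighbourhood

/-! ### Isomorphisms of balls -/

namespace RootedNetwork

variable {M : Type v} {A B C : RootedNetwork.{u} M} {R R' R'' : M → M → Prop} {m n : ℕ}

theorem ball_eq_nbhd (A : RootedNetwork.{u} M) (n : ℕ) : A.ball n = nbhd A.graph A.root n :=
  Set.ext fun _ => (mem_nbhd_iff_dist_le A.connected).symm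

/-- The isomorphism is only defined on the `n`-ball, but step-by-step access to a vertex within `k ≤
n` steps of the root never leaves that ball. Hence smaller balls are preserved, which makes
restriction of ball isomorphisms possible. -/
theorem map_mem_nbhd (φ : A.graph.induce (A.ball n) ≃g B.graph.induce (B.ball n))
    (hφ : ∀ a : A.ball n, (a : A.V) = A.root → (φ a : B.V) = B.root) {k : ℕ} (hk : k ≤ n)
    (a : A.ball n) (ha : (a : A.V) ∈ nbhd A.graph A.root k) :
    (φ a : B.V) ∈ nbhd B.graph B.root k := by
  induction k generalizing a with
  | zero => exact hφ a ha
  | succ k ih =>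
    obtain ⟨b, hb, hab⟩ := ha
    have hb' : b ∈ A.ball n := by
      rw [ball_eq_nbhd]
      exact nbhd_mono _ _ (by omega) hb
    refine ⟨φ ⟨b, hb'⟩, ih (by omega) ⟨b, hb'⟩ hb, ?_⟩
    rcases hab with hab | hab
    · exact Or.inl (by congr 2; exact Subtype.ext hab)
    · exact Or.inr (φ.map_adj_iff (v := ⟨b, hb'⟩) (w := a).2 hab)

theorem symm_root (φ : A.graph.induce (A.ball n) ≃g B.graph.induce (B.ball n))
    (hφ : ∀ a : A.ball n, (a : A.V) = A.root → (φ a : B.V) = B.root) (b : B.ball n)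
    (hb : (b : B.V) = B.root) : (φ.symm b : A.V) = A.root := by
  have h0 : A.root ∈ A.ball n := by rw [ball_eq_nbhd]; exact mem_nbhd_self _ _ _
  have : φ ⟨A.root, h0⟩ = b := Subtype.ext ((hφ ⟨A.root, h0⟩ rfl).trans hb.symm)
  rw [← this]
  simp

theorem BallIso.symm (h : BallIso R n A B) (hR : ∀ a b, R a b → R' b a) : BallIso R' n B A := by
  obtain ⟨φ, hr, hv, he⟩ := h
  refine ⟨φ.symm, symm_root φ hr, fun b => ?_, fun a b hab => ?_⟩
  · simpa using hR _ _ (hv (φ.symm b))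
  · simpa using hR _ _ (he (φ.symm a) (φ.symm b) (φ.symm.map_adj_iff (v := a) (w := b).2 hab))

theorem BallIso.trans (h : BallIso R n A B) (h' : BallIso R' n B C)
    (hR : ∀ a b c, R a b → R' b c → R'' a c) : BallIso R'' n A C := by
  obtain ⟨φ, hr, hv, he⟩ := h
  obtain ⟨ψ, hr', hv', he'⟩ := h'
  refine ⟨φ.trans ψ, fun a ha => hr' _ (hr a ha), fun a => hR _ _ _ (hv a) (hv' _),
    fun a b hab => hR _ _ _ (he a b hab) (he' _ _ (φ.map_adj_iff (v := a) (w := b).2 hab))⟩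

theorem BallIso.mono (h : BallIso R n A B) (hmn : m ≤ n) (hR : ∀ a b, R a b → R' a b) :
    BallIso R' m A B := by
  obtain ⟨φ, hr, hv, he⟩ := h
  have hA : ∀ {a}, a ∈ A.ball m → a ∈ A.ball n := fun {a} ha => le_trans ha hmn
  have hB : ∀ {a}, a ∈ B.ball m → a ∈ B.ball n := fun {a} ha => le_trans ha hmn
  have h1 : ∀ a : A.ball m, (φ ⟨a, hA a.2⟩ : B.V) ∈ B.ball m := fun a => by
    rw [ball_eq_nbhd]
    exact map_mem_nbhd φ hr hmn _ (by rw [← ball_eq_nbhd]; exact a.2)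
  have h2 : ∀ b : B.ball m, (φ.symm ⟨b, hB b.2⟩ : A.V) ∈ A.ball m := fun b => by
    rw [ball_eq_nbhd]
    exact map_mem_nbhd φ.symm (symm_root φ hr) hmn _ (by rw [← ball_eq_nbhd]; exact b.2)
  refine ⟨⟨⟨fun a => ⟨φ ⟨a, hA a.2⟩, h1 a⟩, fun b => ⟨φ.symm ⟨b, hB b.2⟩, h2 b⟩,
    fun a => by simp, fun b => by simp⟩, ?_⟩, ?_, ?_, ?_⟩
  · intro a b
    exact φ.map_adj_iff (v := ⟨a, hA a.2⟩) (w := ⟨b, hA b.2⟩)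
  · exact fun a ha => hr ⟨a, hA a.2⟩ ha
  · exact fun a => hR _ _ (hv ⟨a, hA a.2⟩)
  · exact fun a b hab => hR _ _ (he ⟨a, hA a.2⟩ ⟨b, hA b.2⟩ hab)

theorem map_mem_nbhd_of_iso (φ : A.graph ≃g B.graph) (hr : φ A.root = B.root) {n : ℕ} {a : A.V}
    (ha : a ∈ nbhd A.graph A.root n) : φ a ∈ nbhd B.graph B.root n := by
  induction n generalizing a with
  | zero => rw [show a = A.root from ha]; exact hr
  | succ n ih =>
    obtain ⟨b, hb, hab⟩ := ha
    exact ⟨φ b, ih hb, hab.imp (congrArg φ) φ.map_adj_iff.2⟩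

theorem Iso.ballIso (h : Iso A B) (n : ℕ) : BallIso (· = ·) n A B := by
  obtain ⟨φ, hr, hv, he⟩ := h
  have hb : Set.BijOn φ (A.ball n) (B.ball n) := by
    simp only [ball_eq_nbhd]
    refine ⟨fun a ha => map_mem_nbhd_of_iso φ hr ha, φ.injective.injOn, fun b hb => ?_⟩
    exact ⟨φ.symm b, map_mem_nbhd_of_iso φ.symm (by rw [← hr]; simp) hb, by simp⟩
  exact ⟨φ.induce hb, fun a ha => (congrArg φ ha).trans hr, fun a => (hv a).symm,
    fun a b hab => (he a b hab).symm⟩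

end RootedNetwork

namespace GStar

variable {M : Type v} {R R' R'' : M → M → Prop} {m n : ℕ} {x y z : GStar.{u} M}

/-- Frees the relation on classes from the choice of representatives: full isomorphisms restrict to
balls and preserve marks exactly, so they can be composed on either side. -/
theorem ballIso_mk {A B : RootedNetwork.{u} M} :
    BallIso R n (mk A) (mk B) ↔ A.BallIso R n B := by
  refine ⟨?_, fun h => ⟨A, B, rfl, rfl, h⟩⟩
  rintro ⟨A', B', hA, hB, h⟩
  have hA : RootedNetwork.Iso A' A := Quotient.exact hA
  have hB : RootedNetwork.Iso B' B := Quotient.exact hB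
  exact ((hA.symm.ballIso n).trans h (R'' := R) (by rintro a b c rfl h; exact h)).trans
    (hB.ballIso n) (by rintro a b c h rfl; exact h)

theorem BallIso.symm (h : BallIso R n x y) (hR : ∀ a b, R a b → R' b a) : BallIso R' n y x := by
  obtain ⟨A, B, rfl, rfl, h⟩ := h
  exact ⟨B, A, rfl, rfl, h.symm hR⟩

theorem BallIso.trans (h : BallIso R n x y) (h' : BallIso R' n y z)
    (hR : ∀ a b c, R a b → R' b c → R'' a c) : BallIso R'' n x z := by
  obtain ⟨A, B, rfl, rfl, h⟩ := h
  obtain ⟨C, rfl⟩ := Quotient.exists_rep z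
  exact ⟨A, C, rfl, rfl, h.trans (ballIso_mk.1 h') hR⟩

theorem BallIso.mono (h : BallIso R n x y) (hmn : m ≤ n) (hR : ∀ a b, R a b → R' a b) :
    BallIso R' m x y := by
  obtain ⟨A, B, rfl, rfl, h⟩ := h
  exact ⟨A, B, rfl, rfl, h.mono hmn hR⟩

theorem ballIso_refl (hR : ∀ a, R a a) (n : ℕ) (x : GStar.{u} M) : BallIso R n x x := by
  obtain ⟨A, rfl⟩ := Quotient.exists_rep x
  exact ⟨A, A, rfl, rfl, ((RootedNetwork.Iso.refl A).ballIso n).mono le_rfl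
    (by rintro a b rfl; exact hR a)⟩

end GStar

/-! ### The pseudometric on the space of networks -/

namespace GStar

variable {M : Type v} [MetricSpace M] {x y z : GStar.{u} M}

theorem netDist_nonneg (x y : GStar.{u} M) : 0 ≤ netDist x y := ENNReal.toReal_nonneg

theorem netDist_le_one (x y : GStar.{u} M) : netDist x y ≤ 1 := by
  refine ENNReal.toReal_le_of_le_ofReal zero_le_one ?_
  simp

theorem netDist_le_of_ballIso {r : ℝ≥0} (hr : 0 < r)
    (h : BallIso (fun a b : M => dist a b < 1 / (r : ℝ)) ⌊r⌋₊ x y) :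
    netDist x y ≤ 1 / (1 + r) := by
  have h1 : (r : ℝ≥0∞) ≤ agreement x y := le_iSup₂_of_le r ⟨hr, h⟩ le_rfl
  refine ENNReal.toReal_le_of_le_ofReal (by positivity) ?_
  rw [one_div, ENNReal.ofReal_inv_of_pos (by positivity), ENNReal.inv_le_inv,
    ENNReal.ofReal_add zero_le_one r.coe_nonneg]
  simpa using h1

/-- The supremum defining `agreement` need not be attained, but admissible radii are closed
downwards, so every `r` strictly below it is admissible. -/
theorem ballIso_of_netDist_lt {r : ℝ≥0} (hr : 0 < r) (h : netDist x y < 1 / (1 + r)) :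
    BallIso (fun a b : M => dist a b < 1 / (r : ℝ)) ⌊r⌋₊ x y := by
  have h1 : (r : ℝ≥0∞) < agreement x y := by
    by_contra! hle
    refine h.not_ge ?_
    rw [netDist, ← ENNReal.toReal_ofReal (r := 1 / (1 + (r : ℝ))) (by positivity)]
    refine ENNReal.toReal_mono ?_ ?_
    · simp
    · rw [one_div, ENNReal.ofReal_inv_of_pos (by positivity), ENNReal.inv_le_inv,
        ENNReal.ofReal_add zero_le_one r.coe_nonneg]
      simpa using hle
  obtain ⟨r', h2⟩ := lt_iSup_iff.1 h1
  obtain ⟨⟨-, h3⟩, h4⟩ := lt_iSup_iff.1 h2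
  have h5 : r ≤ r' := by exact_mod_cast h4.le
  exact h3.mono (Nat.floor_mono h5) fun a b hab => hab.trans_le
    (one_div_le_one_div_of_le (by exact_mod_cast hr) (by exact_mod_cast h5))

theorem netDist_le_of_ballIso_eq {n : ℕ} (hn : 0 < n) (h : BallIso (fun a b : M => a = b) n x y) :
    netDist x y ≤ 1 / (1 + n) := by
  have := netDist_le_of_ballIso (x := x) (y := y) (r := (n : ℝ≥0)) (by exact_mod_cast hn)
    (by
      rw [Nat.floor_natCast]
      refine h.mono le_rfl ?_
      rintro a b rfl
      rw [dist_self]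
      have : (0 : ℝ) < n := by exact_mod_cast hn
      simpa using this)
  simpa using this

theorem netDist_self (x : GStar.{u} M) : netDist x x = 0 := by
  refine le_antisymm (ge_of_tendsto' (tendsto_one_div_add_atTop_nhds_zero_nat (𝕜 := ℝ)) fun n => ?_)
    (netDist_nonneg _ _)
  rcases Nat.eq_zero_or_pos n with rfl | hn
  · simpa using netDist_le_one x x
  · rw [add_comm]
    exact netDist_le_of_ballIso_eq hn (ballIso_refl (fun _ => rfl) n x)

theorem agreement_comm (x y : GStar.{u} M) : agreement x y = agreement y x := by
  have key : ∀ (x y : GStar.{u} M) (r : ℝ≥0),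
      BallIso (fun a b : M => dist a b < 1 / (r : ℝ)) ⌊r⌋₊ x y →
      BallIso (fun a b : M => dist a b < 1 / (r : ℝ)) ⌊r⌋₊ y x := fun x y r h =>
    h.symm fun a b hab => by rwa [dist_comm]
  unfold agreement
  refine iSup_congr fun r => ?_
  have : (0 < r ∧ BallIso (fun a b : M => dist a b < 1 / (r : ℝ)) ⌊r⌋₊ x y) ↔
      (0 < r ∧ BallIso (fun a b : M => dist a b < 1 / (r : ℝ)) ⌊r⌋₊ y x) :=
    and_congr_right fun _ => ⟨key x y r, key y x r⟩
  simp only [this]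

theorem netDist_comm (x y : GStar.{u} M) : netDist x y = netDist y x := by
  rw [netDist, netDist, agreement_comm]

theorem netDist_triangle_of_ballIso {r₁ r₂ : ℝ≥0} (h₁ : 0 < r₁) (h₂ : 0 < r₂)
    (hxy : BallIso (fun a b : M => dist a b < 1 / (r₁ : ℝ)) ⌊r₁⌋₊ x y)
    (hyz : BallIso (fun a b : M => dist a b < 1 / (r₂ : ℝ)) ⌊r₂⌋₊ y z) :
    netDist x z ≤ 1 / (1 + r₁) + 1 / (1 + r₂) := by
  have p₁ : (0 : ℝ) < r₁ := h₁
  have p₂ : (0 : ℝ) < r₂ := h₂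
  -- This choice makes 1/r = 1/r₁ + 1/r₂, so the tolerances on the marks add up exactly. The bound
  -- on distances is then subadditivity of t ↦ t/(1 + t) at t = 1/r.
  set r : ℝ≥0 := r₁ * r₂ / (r₁ + r₂) with hr
  have hpos : 0 < r := by positivity
  have hr₁ : r ≤ r₁ := by
    rw [hr, div_le_iff₀ (by positivity)]
    gcongr
    exact le_add_self
  have hr₂ : r ≤ r₂ := by
    rw [hr, div_le_iff₀ (by positivity), mul_comm]
    gcongr
    exact le_self_add
  have hinv : 1 / (r : ℝ) = 1 / (r₁ : ℝ) + 1 / (r₂ : ℝ) := by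
    rw [hr]
    push_cast
    field_simp
    ring
  have hxz : BallIso (fun a b : M => dist a b < 1 / (r : ℝ)) ⌊r⌋₊ x z := by
    refine (hxy.mono (Nat.floor_mono hr₁) fun _ _ => id).trans
      (hyz.mono (Nat.floor_mono hr₂) fun _ _ => id) fun a b c hab hbc => ?_
    rw [hinv]
    exact (dist_triangle a b c).trans_lt (add_lt_add hab hbc)
  refine (netDist_le_of_ballIso hpos hxz).trans ?_
  rw [hr]
  push_cast
  rw [div_add_div _ _ (by positivity) (by positivity), div_le_div_iff₀ (by positivity)
    (by positivity)]
  field_simp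
  nlinarith [mul_pos p₁ p₂, mul_pos (mul_pos p₁ p₂) p₁, mul_pos (mul_pos p₁ p₂) p₂]

theorem netDist_triangle (x y z : GStar.{u} M) :
    netDist x z ≤ netDist x y + netDist y z := by
  refine le_of_forall_pos_le_add fun ε hε => ?_
  -- The slack ε/2 provides the strict inequality needed to extract ball isomorphisms. If a distance
  -- plus slack reaches 1, the claim is trivial because distances never exceed 1.
  by_cases h₁ : netDist x y + ε / 2 < 1
  · by_cases h₂ : netDist y z + ε / 2 < 1
    · have key : ∀ a b : GStar.{u} M, netDist a b + ε / 2 < 1 → ∃ r : ℝ≥0, 0 < r ∧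
          1 / (1 + (r : ℝ)) = netDist a b + ε / 2 := fun a b hab => by
        have h0 : 0 < netDist a b + ε / 2 := by have := netDist_nonneg a b; positivity
        have h3 : 0 < 1 / (netDist a b + ε / 2) - 1 := by
          rw [sub_pos, lt_div_iff₀ h0]; simpa using hab
        refine ⟨NNReal.mk _ h3.le, h3, ?_⟩
        rw [NNReal.coe_mk, add_sub_cancel, one_div_one_div]
      obtain ⟨r₁, hr₁, e₁⟩ := key x y h₁
      obtain ⟨r₂, hr₂, e₂⟩ := key y z h₂
      refine (netDist_triangle_of_ballIso hr₁ hr₂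
        (ballIso_of_netDist_lt (x := x) (y := y) hr₁ (by rw [e₁]; linarith))
        (ballIso_of_netDist_lt (x := y) (y := z) hr₂ (by rw [e₂]; linarith))).trans ?_
      rw [e₁, e₂]
      linarith
    · linarith [netDist_le_one x z, netDist_nonneg x y]
  · linarith [netDist_le_one x z, netDist_nonneg y z]

/-- The topology stays the given one by definition. A pseudometric is enough for limits of
measurable maps and for testing weak convergence on Lipschitz functions. -/
noncomputable instance : PseudoMetricSpace (GStar.{u} M) :=
  PseudoMetricSpace.ofDistTopology netDist netDist_self netDist_comm netDist_triangle
    fun _ => Iff.rfl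

theorem dist_eq_netDist (x y : GStar.{u} M) : dist x y = netDist x y := rfl

/-- A criterion for convergence: eventually, balls are isomorphic with marks close together. -/
theorem tendsto_of_eventually_ballIso {X : ℕ → GStar.{u} M}
    (h : ∀ (n : ℕ) (ε : ℝ), 0 < ε →
      ∀ᶠ k in atTop, BallIso (fun a b : M => dist a b < ε) n (X k) x) :
    Tendsto X atTop (𝓝 x) := by
  rw [Metric.tendsto_atTop']
  intro ε hε
  obtain ⟨n, hn⟩ := exists_nat_one_div_lt hε
  obtain ⟨K, hK⟩ := eventually_atTop.1 (h (n + 1) (1 / ((n : ℝ) + 1)) (by positivity))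
  refine ⟨K, fun k hk => ?_⟩
  have := netDist_le_of_ballIso (x := X k) (y := x) (r := ((n + 1 : ℕ) : ℝ≥0))
    (by positivity) (by
      rw [Nat.floor_natCast]
      exact (hK k hk.le).mono le_rfl fun a b hab => by simpa using hab)
  rw [dist_eq_netDist]
  refine this.trans_lt (lt_of_le_of_lt ?_ hn)
  refine one_div_le_one_div_of_le (by positivity) ?_
  push_cast
  linarith

end GStar

/-! ### Networks obtained from graphs on a fixed vertex set -/

namespace GStar

section OfGraph

variable {W : Type u} {M : Type v} {G G' : SimpleGraph W} {vm vm' : W → M} {em em' : W → W → M}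
  {o : W}

/-- The component of `o` in a locally finite graph, as a rooted network. -/
def component (G : SimpleGraph W) (hG : ∀ a, (G.neighborSet a).Finite) (vm : W → M)
    (em : W → W → M) (o : W) : RootedNetwork.{u} M where
  V := (G.connectedComponentMk o).supp
  graph := G.induce (G.connectedComponentMk o).supp
  vmark := fun a => vm a
  emark := fun a b => em a b
  root := ⟨o, rfl⟩
  connected := (G.connectedComponentMk o).connected_toSimpleGraph
  locallyFinite := fun a =>
    ((hG a).preimage Subtype.val_injective.injOn).subset fun _ hb => hb

theorem ofGraph_of_finite (hG : ∀ a, (G.neighborSet a).Finite) :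
    ofGraph G vm em o = mk (component G hG vm em o) := dif_pos hG

theorem coe_mem_ball_component_iff (hG : ∀ a, (G.neighborSet a).Finite) {n : ℕ}
    (a : (component G hG vm em o).V) :
    a ∈ (component G hG vm em o).ball n ↔ (show (G.connectedComponentMk o).supp from a : W) ∈
      nbhd G o n := by
  rw [RootedNetwork.ball_eq_nbhd]
  exact coe_mem_nbhd_iff n a

theorem mem_supp_of_mem_nbhd {n : ℕ} {a : W} (ha : a ∈ nbhd G o n) :
    a ∈ (G.connectedComponentMk o).supp :=
  SimpleGraph.ConnectedComponent.eq.2 (reachable_of_mem_nbhd ha).symm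

/-- The isomorphism is the identity on vertices: the hypothesis on adjacency makes the two
neighbourhoods the same set. -/
theorem ballIso_ofGraph {R : M → M → Prop} {n : ℕ} (hG : ∀ a, (G.neighborSet a).Finite)
    (hG' : ∀ a, (G'.neighborSet a).Finite)
    (hn : ∀ a ∈ nbhd G o n, ∀ b, G.Adj a b ↔ G'.Adj a b)
    (hv : ∀ a ∈ nbhd G o n, R (vm a) (vm' a))
    (he : ∀ a ∈ nbhd G o n, ∀ b, G.Adj a b → R (em a b) (em' a b)) :
    BallIso R n (ofGraph G vm em o) (ofGraph G' vm' em' o) := by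
  rw [ofGraph_of_finite hG, ofGraph_of_finite hG', ballIso_mk]
  have hnb : nbhd G' o n = nbhd G o n := nbhd_congr hn n (Nat.le_succ n)
  have h1 : ∀ a : (component G hG vm em o).ball n,
      ((show (G.connectedComponentMk o).supp from a.1) : W) ∈ nbhd G o n := fun a =>
    (coe_mem_ball_component_iff hG a.1).1 a.2
  have h2 : ∀ a : (component G' hG' vm' em' o).ball n,
      ((show (G'.connectedComponentMk o).supp from a.1) : W) ∈ nbhd G o n := fun a =>
    hnb.subset ((coe_mem_ball_component_iff hG' a.1).1 a.2)
  refine ⟨⟨⟨fun a => ⟨⟨_, mem_supp_of_mem_nbhd (hnb.symm.subset (h1 a))⟩,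
      (coe_mem_ball_component_iff hG' _).2 (hnb.symm.subset (h1 a))⟩,
    fun a => ⟨⟨_, mem_supp_of_mem_nbhd (h2 a)⟩,
      (coe_mem_ball_component_iff hG _).2 (h2 a)⟩, fun a => rfl, fun a => rfl⟩, ?_⟩, ?_, ?_, ?_⟩
  · intro a b
    exact (hn _ (h1 a) _).symm
  · intro a ha
    have := congrArg Subtype.val ha
    exact Subtype.ext this
  · exact fun a => hv _ (h1 a)
  · exact fun a b hab => he _ (h1 a) _ hab

/-- The conventional value is that of an isolated root, so a graph that is not locally finite may be
replaced by the empty graph. -/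
theorem ofGraph_of_not_finite (hG : ¬ ∀ a, (G.neighborSet a).Finite) :
    ofGraph G vm em o = ofGraph ⊥ vm em o := by
  have hbot : ∀ a, ((⊥ : SimpleGraph W).neighborSet a).Finite := fun a => by
    simp
  rw [ofGraph_of_finite hbot, ofGraph, dif_neg hG]
  have hsub : ∀ a : ((⊥ : SimpleGraph W).connectedComponentMk o).supp, (a : W) = o := by
    rintro ⟨a, ha⟩
    have := SimpleGraph.ConnectedComponent.eq.1 ha
    simpa using this
  refine Quotient.sound ⟨⟨⟨fun _ => ⟨o, rfl⟩, fun _ => PUnit.unit, fun _ => rfl,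
    fun a => Subtype.ext (hsub a).symm⟩, ?_⟩, rfl, fun _ => rfl, ?_⟩
  · intro a b
    exact Iff.rfl
  · exact fun a b hab => hab.elim

theorem ofGraph_equiv (e : W ≃ W) (hadj : ∀ a b, G'.Adj (e a) (e b) ↔ G.Adj a b)
    (hv : ∀ a, vm' (e a) = vm a) (he : ∀ a b, em' (e a) (e b) = em a b) (o : W) :
    ofGraph G' vm' em' (e o) = ofGraph G vm em o := by
  -- Local finiteness transfers along `e`, so it fails on both sides at once, and then both graphs
  -- can be replaced by empty ones.
  wlog hG : ∀ a, (G.neighborSet a).Finite generalizing G G'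
  · have hG' : ¬ ∀ a, (G'.neighborSet a).Finite := fun hG' => hG fun a =>
      ((hG' (e a)).preimage e.injective.injOn).subset fun b hb => (hadj a b).2 hb
    rw [ofGraph_of_not_finite hG, ofGraph_of_not_finite hG']
    exact this (by simp) (by simp)
  · have hG' : ∀ a, (G'.neighborSet a).Finite := fun a => by
      refine ((hG (e.symm a)).image e).subset fun b hb => ⟨e.symm b, (hadj _ _).1 ?_, by simp⟩
      simpa using hb
    rw [ofGraph_of_finite hG, ofGraph_of_finite hG']
    let φ : G ≃g G' := ⟨e, hadj _ _⟩
    have hs : ∀ a, e a ∈ (G'.connectedComponentMk (e o)).supp ↔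
        a ∈ (G.connectedComponentMk o).supp := fun a => by
      simp only [SimpleGraph.ConnectedComponent.mem_supp_iff, SimpleGraph.ConnectedComponent.eq]
      exact φ.reachable_iff
    have hiso : (component G hG vm em o).Iso (component G' hG' vm' em' (e o)) := ⟨φ.induce (s := (G.connectedComponentMk o).supp)
      ⟨fun a ha => (hs a).2 ha, e.injective.injOn, fun b hb => ⟨e.symm b, (hs _).1 (by simpa using hb),
        by simp [φ]⟩⟩, rfl, fun a => hv _, fun a b _ => he _ _⟩
    exact (Quotient.sound hiso).symm

end OfGraph

/-! ### Measurability of random networks -/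

section Measurability

variable {Ω : Type*} [MeasurableSpace Ω] {W : Type u} [Countable W] {M : Type v}

/-- A function that takes countably many values, each determined by countably many
measurable alternatives, is measurable. -/
theorem measurable_of_countable_fibers {β : Type*} [MeasurableSpace β] {ι : Type*} [Countable ι]
    {f : Ω → β} (D : Ω → ι) (hD : ∀ i, MeasurableSet (D ⁻¹' {i}))
    (hf : ∀ ω ω', D ω = D ω' → f ω = f ω') : Measurable f := by
  intro A _
  have : f ⁻¹' A = ⋃ i ∈ D '' (f ⁻¹' A), D ⁻¹' {i} := by
    ext ω
    simp only [Set.mem_iUnion, Set.mem_preimage, Set.mem_singleton_iff, exists_prop, Set.mem_image]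
    constructor
    · exact fun h => ⟨D ω, ⟨ω, h, rfl⟩, rfl⟩
    · rintro ⟨i, ⟨ω', h, rfl⟩, h'⟩
      rwa [hf ω ω' h']
  rw [this]
  exact MeasurableSet.biUnion (Set.to_countable _) fun i _ => hD i

variable [MetricSpace M] [TopologicalSpace.SeparableSpace M] [MeasurableSpace M] [BorelSpace M]
  {G : Ω → SimpleGraph W} {vm : Ω → W → M}

theorem measurableSet_locallyFinite (hG : ∀ a b, MeasurableSet {ω | (G ω).Adj a b}) :
    MeasurableSet {ω | ∀ a, ((G ω).neighborSet a).Finite} := by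
  have : {ω | ∀ a, ((G ω).neighborSet a).Finite} =
      ⋂ a, ⋃ F : Finset W, ⋂ b, ({ω | (G ω).Adj a b}ᶜ ∪ {_ω | b ∈ F}) := by
    ext ω
    simp only [Set.mem_iInter, Set.mem_iUnion]
    refine forall_congr' fun a => ⟨fun h => ⟨h.toFinset, fun b => ?_⟩, ?_⟩
    · by_cases hb : (G ω).Adj a b
      · exact Or.inr (h.mem_toFinset.2 hb)
      · exact Or.inl hb
    · rintro ⟨F, hF⟩
      exact F.finite_toSet.subset fun b hb => (hF b).resolve_left fun h => h hb
  rw [this]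
  exact .iInter fun a => .iUnion fun F => .iInter fun b => (hG a b).compl.union (.const _)

/-- The class is a pointwise limit of classes with countably many values: only edges among finitely
many vertices are kept, and marks are rounded to points of a dense sequence. Around the root each
ball is eventually reproduced with marks as close as desired. -/
theorem measurable_ofGraph_of_finite (hG : ∀ a b, MeasurableSet {ω | (G ω).Adj a b})
    (hvm : ∀ a, Measurable fun ω => vm ω a) (em : W → W → M) (o : W)
    (hfin : ∀ ω a, ((G ω).neighborSet a).Finite) :
    Measurable fun ω => ofGraph (G ω) (vm ω) em o := by
  classical
  have : Nonempty M := ⟨em o o⟩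
  obtain ⟨enc, henc⟩ := exists_injective_nat W
  let d : ℕ → M := TopologicalSpace.denseSeq M
  have hsmall : ∀ k, {a | enc a < k}.Finite := fun k =>
    (Set.finite_Iio k).preimage henc.injOn
  -- the graph with the edges between the first `k` vertices, and with discretised marks
  let Gk : ℕ → Ω → SimpleGraph W := fun k ω =>
    { Adj := fun a b => (G ω).Adj a b ∧ enc a < k ∧ enc b < k
      symm := ⟨fun a b h => ⟨h.1.symm, h.2.2, h.2.1⟩⟩
      loopless := ⟨fun a h => (G ω).loopless.irrefl a h.1⟩ }
  let vk : ℕ → Ω → W → M := fun k ω a =>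
    if enc a < k then SimpleFunc.nearestPt d k (vm ω a) else d 0
  have hGk : ∀ k ω a, ((Gk k ω).neighborSet a).Finite := fun k ω a =>
    (hsmall k).subset fun b hb => hb.2.2
  have hmeas : ∀ k, Measurable fun ω => ofGraph (Gk k ω) (vk k ω) em o := by
    intro k
    have : Fintype {a | enc a < k} := (hsmall k).fintype
    let D : Ω → ({a | enc a < k} → {a | enc a < k} → Prop) × ({a | enc a < k} → ℕ) := fun ω =>
      (fun a b => (G ω).Adj a b, fun a => SimpleFunc.nearestPtInd d k (vm ω a))
    refine measurable_of_countable_fibers D ?_ ?_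
    · rintro ⟨p, q⟩
      have : D ⁻¹' {(p, q)} = (⋂ a : {a | enc a < k}, ⋂ b : {a | enc a < k},
          {ω | (G ω).Adj a b ↔ p a b}) ∩
          ⋂ a : {a | enc a < k}, (fun ω => SimpleFunc.nearestPtInd d k (vm ω a)) ⁻¹' {q a} := by
        ext ω
        simp only [D, Set.mem_preimage, Set.mem_singleton_iff, Prod.mk.injEq, funext_iff,
          Set.mem_inter_iff, Set.mem_iInter]
        refine and_congr (forall_congr' fun a => forall_congr' fun b => ?_) Iff.rfl
        exact propext_iff
      rw [this]
      refine (MeasurableSet.iInter fun a => .iInter fun b => ?_).inter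
        (MeasurableSet.iInter fun a => ?_)
      · by_cases hp : p a b
        · simpa [hp] using hG a b
        · have : {ω | (G ω).Adj a b ↔ p a b} = {ω | (G ω).Adj a b}ᶜ := by
            ext ω
            simp [hp]
          rw [this]
          exact (hG a b).compl
      · exact ((SimpleFunc.measurable _).comp (hvm a)) (measurableSet_singleton _)
    · intro ω ω' hD
      have h1 : Gk k ω = Gk k ω' := by
        ext a b
        refine and_congr_left fun hab => ?_
        exact iff_of_eq (congrFun (congrFun (congrArg Prod.fst hD) ⟨a, hab.1⟩) ⟨b, hab.2⟩)
      have h2 : vk k ω = vk k ω' := by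
        ext a
        by_cases ha : enc a < k
        · simp only [vk, if_pos ha, SimpleFunc.nearestPt, SimpleFunc.map_apply]
          exact congrArg d (congrFun (congrArg Prod.snd hD) ⟨a, ha⟩)
        · simp only [vk, if_neg ha]
      simp only [h1, h2]
  refine measurable_of_tendsto_metrizable hmeas (tendsto_pi_nhds.2 fun ω => ?_)
  refine tendsto_of_eventually_ballIso fun n ε hε => ?_
  -- Radius `n + 1`, because the truncation must also keep all edges leaving the `n`-ball.
  have hball := finite_nbhd (hfin ω) o (n + 1)
  have hev : ∀ᶠ k in atTop, ∀ a ∈ nbhd (G ω) o (n + 1),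
      enc a < k ∧ dist (SimpleFunc.nearestPt d k (vm ω a)) (vm ω a) < ε := by
    rw [(Set.Finite.eventually_all hball)]
    intro a _
    refine (eventually_gt_atTop (enc a)).and ?_
    have : Tendsto (fun k => SimpleFunc.nearestPt d k (vm ω a)) atTop (𝓝 (vm ω a)) :=
      SimpleFunc.tendsto_nearestPt (TopologicalSpace.denseRange_denseSeq M _)
    exact (Metric.tendsto_nhds.1 this) ε hε
  filter_upwards [hev] with k hk
  refine (ballIso_ofGraph (R := fun a b => dist a b < ε) (hfin ω) (hGk k ω) ?_ ?_ ?_).symm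
    fun a b hab => by rwa [dist_comm]
  · intro a ha b
    refine ⟨fun hab => ⟨hab, (hk a (nbhd_subset_succ _ _ _ ha)).1, (hk b ⟨a, ha, Or.inr hab⟩).1⟩,
      fun hab => hab.1⟩
  · intro a ha
    have := hk a (nbhd_subset_succ _ _ _ ha)
    simp only [vk, if_pos this.1]
    rw [dist_comm]
    exact this.2
  · intro a _ b _
    simpa using hε

theorem measurable_ofGraph (hG : ∀ a b, MeasurableSet {ω | (G ω).Adj a b})
    (hvm : ∀ a, Measurable fun ω => vm ω a) (em : W → W → M) (o : W) :
    Measurable fun ω => ofGraph (G ω) (vm ω) em o := by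
  classical
  have hL := measurableSet_locallyFinite hG
  have key : (fun ω => ofGraph (G ω) (vm ω) em o) = fun ω => ofGraph
      (if ∀ a, ((G ω).neighborSet a).Finite then G ω else ⊥) (vm ω) em o := by
    funext ω
    split_ifs with h
    · rfl
    · exact ofGraph_of_not_finite h
  rw [key]
  refine measurable_ofGraph_of_finite (fun a b => ?_) hvm em o fun ω a => ?_
  · have : {ω | (if ∀ a, ((G ω).neighborSet a).Finite then G ω else ⊥).Adj a b} =
        {ω | ∀ a, ((G ω).neighborSet a).Finite} ∩ {ω | (G ω).Adj a b} := by
      ext ω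
      by_cases h : ∀ a, ((G ω).neighborSet a).Finite
      · simp [h]
      · simp only [Set.mem_ofPred_eq, Set.mem_inter_iff, h, if_false, false_and]
        exact Iff.rfl
    rw [this]
    exact hL.inter (hG a b)
  · split_ifs with h
    · exact h a
    · simp

end Measurability

end GStar

/-! The pointwise ergodic theorem -/

section Ergodic

variable {X : Type*} {T : X → X} {f : X → ℝ}

/-- The maximum of the first Birkhoff sums, starting from the empty one. -/
noncomputable def maxSum (T : X → X) (f : X → ℝ) : ℕ → X → ℝ
  | 0, _ => 0
  | n + 1, x => max 0 (f x + maxSum T f n (T x))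

theorem maxSum_nonneg (n : ℕ) (x : X) : 0 ≤ maxSum T f n x := by
  cases n with
  | zero => exact le_rfl
  | succ n => exact le_max_left _ _

theorem monotone_maxSum (x : X) : Monotone fun n => maxSum T f n x := by
  refine monotone_nat_of_le_succ fun n => ?_
  induction n generalizing x with
  | zero => exact maxSum_nonneg 1 x
  | succ n ih => exact max_le_max le_rfl (by linarith [ih (T x)])

theorem birkhoffSum_le_maxSum (n : ℕ) (x : X) : birkhoffSum T f n x ≤ maxSum T f n x := by
  induction n generalizing x with
  | zero => simp [maxSum]
  | succ n ih =>
    rw [birkhoffSum_succ']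
    exact le_max_of_le_right (by linarith [ih (T x)])

/-- The recursion for `maxSum` relates the maxima at `x` and `T x` up to the finite amount `f x`.
This makes boundedness an exactly invariant event, to which ergodicity applies. -/
theorem bddAbove_maxSum_iff (x : X) :
    BddAbove (Set.range fun n => maxSum T f n (T x)) ↔
      BddAbove (Set.range fun n => maxSum T f n x) := by
  constructor
  · rintro ⟨C, hC⟩
    refine ⟨max 0 (f x + C), ?_⟩
    rintro _ ⟨n, rfl⟩
    refine (monotone_maxSum x (Nat.le_succ n)).trans (max_le_max le_rfl ?_)
    have : maxSum T f n (T x) ≤ C := hC ⟨n, rfl⟩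
    linarith
  · rintro ⟨C, hC⟩
    refine ⟨C - f x, ?_⟩
    rintro _ ⟨n, rfl⟩
    have h1 : maxSum T f (n + 1) x ≤ C := hC ⟨n + 1, rfl⟩
    have h2 : f x + maxSum T f n (T x) ≤ maxSum T f (n + 1) x := le_max_right _ _
    simp only
    linarith

variable [MeasurableSpace X] {μ : Measure X}

theorem measurable_maxSum (hT : Measurable T) (hf : Measurable f) (n : ℕ) :
    Measurable (maxSum T f n) := by
  induction n with
  | zero => exact measurable_const
  | succ n ih => exact measurable_const.max (hf.add (ih.comp hT))

theorem integrable_maxSum (hT : MeasurePreserving T μ μ) [IsFiniteMeasure μ]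
    (hfi : Integrable f μ) (n : ℕ) : Integrable (maxSum T f n) μ := by
  induction n with
  | zero => exact integrable_const 0
  | succ n ih => exact (integrable_const 0).sup (hfi.add (hT.integrable_comp_of_integrable ih))

/-- By ergodicity the maxima are bounded almost everywhere or unbounded almost everywhere. In the
second case M_{n+1} - M_n ∘ T equals `f` for all large n and is dominated by |f|, so its integral
tends to that of `f`. But T preserves the measure and M_n increases in n, so these integrals are
nonnegative, contradicting the negative mean. -/
theorem ae_bddAbove_birkhoffSum [IsProbabilityMeasure μ] (hT : Ergodic T μ) (hf : Measurable f)
    (hfi : Integrable f μ) (hneg : ∫ x, f x ∂μ < 0) :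
    ∀ᵐ x ∂μ, ∃ C, ∀ n, birkhoffSum T f n x ≤ C := by
  have hTm := hT.toMeasurePreserving.measurable
  set A : Set X := {x | BddAbove (Set.range fun n => maxSum T f n x)} with hA
  have hAm : MeasurableSet A := by
    have : A = ⋃ C : ℕ, ⋂ n, {x | maxSum T f n x ≤ C} := by
      ext x
      simp only [Set.mem_iUnion, Set.mem_iInter]
      constructor
      · rintro ⟨C, hC⟩
        obtain ⟨k, hk⟩ := exists_nat_ge C
        exact ⟨k, fun n => (hC ⟨n, rfl⟩).trans hk⟩
      · rintro ⟨C, hC⟩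
        exact ⟨C, by rintro _ ⟨n, rfl⟩; exact hC n⟩
    rw [this]
    exact .iUnion fun C => .iInter fun n =>
      measurableSet_le (measurable_maxSum hTm hf n) measurable_const
  have hAT : T ⁻¹' A = A := Set.ext fun x => bddAbove_maxSum_iff x
  rcases hT.toPreErgodic.ae_mem_or_ae_notMem hAm hAT with h | h
  · filter_upwards [h] with x ⟨C, hC⟩
    exact ⟨C, fun n => (birkhoffSum_le_maxSum n x).trans (hC ⟨n, rfl⟩)⟩
  · exfalso
    refine hneg.not_ge ?_
    have hlim : Tendsto (fun n => ∫ x, (maxSum T f (n + 1) x - maxSum T f n (T x)) ∂μ) atTop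
        (𝓝 (∫ x, f x ∂μ)) := by
      refine tendsto_integral_of_dominated_convergence (fun x => |f x|)
        (fun n => ((measurable_maxSum hTm hf _).sub
          ((measurable_maxSum hTm hf _).comp hTm)).aestronglyMeasurable) hfi.abs ?_ ?_
      · refine fun n => ae_of_all _ fun x => ?_
        have h0 := maxSum_nonneg (T := T) (f := f) n (T x)
        simp only [maxSum, Real.norm_eq_abs]
        rcases max_cases 0 (f x + maxSum T f n (T x)) with ⟨h1, h2⟩ | ⟨h1, h2⟩ <;> rw [h1]
        · rw [zero_sub, abs_neg, abs_of_nonneg h0]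
          exact le_trans (by linarith) (neg_le_abs _)
        · rw [add_sub_cancel_right]
      · filter_upwards [h] with x hx
        have hx' : ¬ BddAbove (Set.range fun n => maxSum T f n (T x)) := fun hb =>
          hx ((bddAbove_maxSum_iff x).1 hb)
        obtain ⟨_, ⟨k, rfl⟩, hk⟩ := not_bddAbove_iff.1 hx' (-f x)
        refine tendsto_const_nhds.congr' ?_
        filter_upwards [eventually_ge_atTop k] with n hn
        have hmono : maxSum T f k (T x) ≤ maxSum T f n (T x) := monotone_maxSum (T x) hn
        simp only [maxSum]
        rw [max_eq_right (by linarith)]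
        ring
    refine ge_of_tendsto' hlim fun n => ?_
    have hi := fun n => integrable_maxSum hT.toMeasurePreserving hfi n
    have hiT : Integrable (fun x => maxSum T f n (T x)) μ :=
      hT.toMeasurePreserving.integrable_comp_of_integrable (hi n)
    rw [integral_sub (hi _) hiT]
    have h1 : ∫ x, maxSum T f n (T x) ∂μ = ∫ x, maxSum T f n x ∂μ := by
      conv_rhs => rw [← hT.toMeasurePreserving.map_eq]
      exact (integral_map hTm.aemeasurable
        (measurable_maxSum hTm hf n).aestronglyMeasurable).symm
    rw [h1, sub_nonneg]
    exact integral_mono (hi _) (hi _) fun x => monotone_maxSum x (Nat.le_succ n)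

/-- Subtracting the mean plus 1/(k+1) makes the mean negative. Using countably many k gives one null
set for all ε. -/
theorem ae_birkhoffSum_le [IsProbabilityMeasure μ] (hT : Ergodic T μ) (hf : Measurable f)
    (hfi : Integrable f μ) :
    ∀ᵐ x ∂μ, ∀ ε > 0, ∃ C, ∀ n : ℕ, birkhoffSum T f n x ≤ n * ∫ y, f y ∂μ + ε * n + C := by
  have key : ∀ k : ℕ, ∀ᵐ x ∂μ, ∃ C, ∀ n : ℕ,
      birkhoffSum T f n x ≤ n * ∫ y, f y ∂μ + 1 / ((k : ℝ) + 1) * n + C := by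
    intro k
    have hk : (0 : ℝ) < 1 / ((k : ℝ) + 1) := by positivity
    have := ae_bddAbove_birkhoffSum (f := fun x => f x - (∫ y, f y ∂μ + 1 / ((k : ℝ) + 1))) hT
      (hf.sub_const _) (hfi.sub (integrable_const _)) (by
        rw [integral_sub hfi (integrable_const _)]
        simp only [integral_const, probReal_univ, one_smul]
        linarith)
    filter_upwards [this] with x ⟨C, hC⟩
    refine ⟨C, fun n => ?_⟩
    have := hC n
    simp only [birkhoffSum, Finset.sum_sub_distrib, Finset.sum_const, Finset.card_range,
      nsmul_eq_mul] at this ⊢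
    linarith
  filter_upwards [ae_all_iff.2 key] with x hx ε hε
  obtain ⟨k, hk⟩ := exists_nat_one_div_lt hε
  obtain ⟨C, hC⟩ := hx k
  refine ⟨C, fun n => (hC n).trans ?_⟩
  gcongr

/-- **Birkhoff's ergodic theorem**, in quantitative form. -/
theorem ae_abs_birkhoffSum_sub_le [IsProbabilityMeasure μ] (hT : Ergodic T μ) (hf : Measurable f)
    (hfi : Integrable f μ) :
    ∀ᵐ x ∂μ, ∀ ε > 0, ∃ C, ∀ n : ℕ, |birkhoffSum T f n x - n * ∫ y, f y ∂μ| ≤ ε * n + C := by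
  filter_upwards [ae_birkhoffSum_le hT hf hfi, ae_birkhoffSum_le hT hf.neg hfi.neg]
    with x h1 h2 ε hε
  obtain ⟨C, hC⟩ := h1 ε hε
  obtain ⟨C', hC'⟩ := h2 ε hε
  refine ⟨max C C', fun n => abs_le.2 ⟨?_, ?_⟩⟩
  · have := hC' n
    simp only [birkhoffSum, Pi.neg_apply, Finset.sum_neg_distrib, integral_neg] at this ⊢
    linarith [le_max_right C C']
  · linarith [hC n, le_max_left C C']

end Ergodic

/-! ### Means over intervals of integers -/

section TwoSided

/-- The primitive of a function on `ℤ` that vanishes at `0`. -/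
noncomputable def primitive (u : ℤ → ℝ) : ℤ → ℝ
  | Int.ofNat n => ∑ k ∈ Finset.range n, u k
  | Int.negSucc n => -∑ k ∈ Finset.range (n + 1), u (-((k : ℤ) + 1))

theorem primitive_add_one (u : ℤ → ℝ) (b : ℤ) : primitive u (b + 1) = primitive u b + u b := by
  rcases b with n | n
  · exact Finset.sum_range_succ _ _
  · rcases n with _ | n
    · change ∑ k ∈ Finset.range 0, u k = -∑ k ∈ Finset.range 1, u (-((k : ℤ) + 1)) + u (-1)
      simp
    · have : Int.negSucc (n + 1) + 1 = Int.negSucc n := by omega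
      rw [this]
      simp only [primitive]
      rw [Finset.sum_range_succ _ (n + 1), Int.negSucc_eq]
      push_cast
      ring

theorem sum_Ico_eq_primitive_sub (u : ℤ → ℝ) {a b : ℤ} (hab : a ≤ b) :
    ∑ t ∈ Finset.Ico a b, u t = primitive u b - primitive u a := by
  induction b, hab using Int.leInduction with
  | base => simp
  | succ b hab ih =>
    have : Finset.Ico a (b + 1) = insert b (Finset.Ico a b) := by
      ext t
      simp only [Finset.mem_Ico, Finset.mem_insert]
      omega
    rw [this, Finset.sum_insert (by simp), ih, primitive_add_one]
    ring

theorem abs_primitive_le {u : ℤ → ℝ} {ε C C' : ℝ}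
    (h : ∀ n : ℕ, |∑ k ∈ Finset.range n, u k| ≤ ε * n + C)
    (h' : ∀ n : ℕ, |∑ k ∈ Finset.range n, u (-((k : ℤ) + 1))| ≤ ε * n + C') (b : ℤ) :
    |primitive u b| ≤ ε * |(b : ℝ)| + max C C' := by
  rcases b with n | n
  · have := h n
    simp only [primitive, Int.ofNat_eq_natCast, Int.cast_natCast, Nat.abs_cast]
    linarith [le_max_left C C']
  · have := h' (n + 1)
    have h1 : |((Int.negSucc n : ℤ) : ℝ)| = ((n + 1 : ℕ) : ℝ) := by
      rw [Int.cast_negSucc, abs_neg, Nat.abs_cast]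
    rw [h1]
    simp only [primitive, abs_neg]
    linarith [le_max_right C C']

/-- `u` has mean `ℓ` over long intervals. -/
def HasMean (u : ℤ → ℝ) (ℓ : ℝ) : Prop :=
  ∀ ε > 0, ∃ C, ∀ a b : ℤ, a ≤ b →
    |∑ t ∈ Finset.Ico a b, u t - (b - a) * ℓ| ≤ ε * (|(a : ℝ)| + |(b : ℝ)|) + C

/-- An interval sum is a difference of two values of the primitive, so growth bounds in the two
directions from 0 suffice, wherever the interval lies. -/
theorem hasMean_of_range {u : ℤ → ℝ} {ℓ : ℝ}
    (h : ∀ ε > 0, ∃ C, ∀ n : ℕ, |∑ k ∈ Finset.range n, u k - n * ℓ| ≤ ε * n + C)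
    (h' : ∀ ε > 0, ∃ C, ∀ n : ℕ,
      |∑ k ∈ Finset.range n, u (-((k : ℤ) + 1)) - n * ℓ| ≤ ε * n + C) : HasMean u ℓ := by
  intro ε hε
  obtain ⟨C, hC⟩ := h ε hε
  obtain ⟨C', hC'⟩ := h' ε hε
  refine ⟨2 * max C C', fun a b hab => ?_⟩
  have key := abs_primitive_le (u := fun t => u t - ℓ) (ε := ε) (C := C) (C' := C')
    (by simpa [Finset.sum_sub_distrib] using hC) (by simpa [Finset.sum_sub_distrib] using hC')
  have h1 : ∑ t ∈ Finset.Ico a b, u t - (b - a) * ℓ = ∑ t ∈ Finset.Ico a b, (u t - ℓ) := by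
    rw [Finset.sum_sub_distrib, Finset.sum_const, Int.card_Ico, nsmul_eq_mul]
    have : (((b - a).toNat : ℕ) : ℝ) = b - a := by
      have h2 : (((b - a).toNat : ℕ) : ℤ) = b - a := Int.toNat_of_nonneg (by omega)
      exact_mod_cast congrArg (Int.cast (R := ℝ)) h2
    rw [this]
  rw [h1, sum_Ico_eq_primitive_sub _ hab]
  refine (abs_sub _ _).trans ?_
  linarith [key a, key b]

/-- The conditions on `K` say that the interval does not drift away from the origin. They give |a| +
|b| ≤ (b - a) + 4|K|, so the error is small relative to the length. -/
theorem HasMean.tendsto {u : ℤ → ℝ} {ℓ : ℝ} (hu : HasMean u ℓ) {a b : ℕ → ℤ} {K : ℤ}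
    (ha : ∀ᶠ n in atTop, a n ≤ K) (hb : ∀ᶠ n in atTop, -K ≤ b n)
    (hlen : Tendsto (fun n => b n - a n) atTop atTop) :
    Tendsto (fun n => (∑ t ∈ Finset.Ico (a n) (b n), u t) / ((b n : ℝ) - a n)) atTop (𝓝 ℓ) := by
  rw [Metric.tendsto_atTop']
  intro ε hε
  obtain ⟨C, hC⟩ := hu (ε / 2) (by positivity)
  have hlen' : Tendsto (fun n => ((b n - a n : ℤ) : ℝ)) atTop atTop :=
    tendsto_intCast_atTop_atTop.comp hlen
  obtain ⟨n₀, hn₀⟩ := eventually_atTop.1 (ha.and (hb.and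
    ((hlen'.eventually_gt_atTop ((ε / 2 * (4 * |(K : ℝ)|) + C) / (ε / 2))).and
      (hlen'.eventually_gt_atTop 0))))
  refine ⟨n₀, fun n hn => ?_⟩
  obtain ⟨h1, h2, h3, h4⟩ := hn₀ n hn.le
  push_cast at h3 h4
  have h1' : (a n : ℝ) ≤ K := by exact_mod_cast h1
  have h2' : -(K : ℝ) ≤ b n := by exact_mod_cast h2
  have hab : a n ≤ b n := by
    have : (a n : ℝ) ≤ b n := by linarith
    exact_mod_cast this
  have h5 : |(a n : ℝ)| + |(b n : ℝ)| ≤ (b n - a n) + 4 * |(K : ℝ)| := by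
    have := le_abs_self (K : ℝ)
    have := abs_nonneg (K : ℝ)
    rcases abs_cases (a n : ℝ) with ⟨e, _⟩ | ⟨e, _⟩ <;>
      rcases abs_cases (b n : ℝ) with ⟨e', _⟩ | ⟨e', _⟩ <;> rw [e, e'] <;> linarith
  rw [div_lt_iff₀ (by positivity)] at h3
  rw [Real.dist_eq, div_sub' h4.ne', abs_div, abs_of_pos h4, div_lt_iff₀ h4]
  refine (hC _ _ hab).trans_lt ?_
  have := mul_le_mul_of_nonneg_left h5 (by positivity : 0 ≤ ε / 2)
  linarith

end TwoSided

/-! ### The two-sided shift -/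

section Shift

variable {Ξ : Type w}

/-- The shift by `t`. -/
def shiftBy (t : ℤ) (x : ℤ → Ξ) : ℤ → Ξ := fun k => x (k + t)

theorem iterate_shift (n : ℕ) (x : ℤ → Ξ) : shift^[n] x = shiftBy n x := by
  induction n generalizing x with
  | zero => funext k; simp [shiftBy]
  | succ n ih =>
    rw [Function.iterate_succ_apply, ih]
    funext k
    simp only [shiftBy, shift]
    congr 1
    push_cast
    ring

variable [MeasurableSpace Ξ]

theorem measurable_shiftBy (t : ℤ) : Measurable (shiftBy t : (ℤ → Ξ) → ℤ → Ξ) :=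
  measurable_pi_lambda _ fun k => measurable_pi_apply (k + t)

/-- The shift as a measurable equivalence. -/
def shiftEquiv (Ξ : Type w) [MeasurableSpace Ξ] : (ℤ → Ξ) ≃ᵐ (ℤ → Ξ) where
  toFun := shift
  invFun := shiftBy (-1)
  left_inv x := by funext k; simp [shift, shiftBy]
  right_inv x := by funext k; simp [shift, shiftBy]
  measurable_toFun := measurable_shiftBy 1
  measurable_invFun := measurable_shiftBy (-1)

theorem iterate_shift_symm (n : ℕ) (x : ℤ → Ξ) :
    (shiftEquiv Ξ).symm^[n] x = shiftBy (-n) x := by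
  induction n generalizing x with
  | zero => funext k; simp [shiftBy]
  | succ n ih =>
    rw [Function.iterate_succ_apply, ih]
    funext k
    change x (k + -(n : ℤ) + -1) = _
    simp only [shiftBy]
    congr 1
    push_cast
    ring

variable {μ : Measure (ℤ → Ξ)}

theorem measurePreserving_shiftBy (hμ : Ergodic shift μ) (t : ℤ) :
    MeasurePreserving (shiftBy t) μ μ := by
  obtain ⟨n, rfl | rfl⟩ := t.eq_nat_or_neg
  · have := hμ.toMeasurePreserving.iterate n
    rwa [show shift^[n] = shiftBy (Ξ := Ξ) n from funext (iterate_shift n)] at this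
  · have h : MeasurePreserving (shiftEquiv Ξ).symm μ μ :=
      MeasurePreserving.symm (shiftEquiv Ξ) hμ.toMeasurePreserving
    have := h.iterate n
    rwa [show (shiftEquiv Ξ).symm^[n] = shiftBy (-(n : ℤ)) from
      funext (iterate_shift_symm n)] at this

/-- **Birkhoff's ergodic theorem** for two-sided sequences. -/
theorem ae_hasMean [IsProbabilityMeasure μ] (hμ : Ergodic shift μ) {f : (ℤ → Ξ) → ℝ}
    (hf : Measurable f) (hfi : Integrable f μ) : ∀ᵐ x ∂μ, HasMean (fun t => f (shiftBy t x)) (∫ y, f y ∂μ) := by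
  -- Negative times are visited by the inverse shift. They begin at -1 rather than 0, whence the
  -- composition of `f` with `shiftBy (-1)`.
  have hμ' : Ergodic (shiftEquiv Ξ).symm μ := Ergodic.symm (e := shiftEquiv Ξ) hμ
  have hpres := measurePreserving_shiftBy hμ (-1)
  have hint : ∫ y, f (shiftBy (-1) y) ∂μ = ∫ y, f y ∂μ := by
    conv_rhs => rw [← hpres.map_eq]
    exact (integral_map hpres.measurable.aemeasurable hf.aestronglyMeasurable).symm
  filter_upwards [ae_abs_birkhoffSum_sub_le hμ hf hfi,
    ae_abs_birkhoffSum_sub_le hμ' (hf.comp (measurable_shiftBy (-1)))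
      (hpres.integrable_comp_of_integrable hfi)] with x h1 h2
  refine hasMean_of_range ?_ ?_
  · simpa only [birkhoffSum, iterate_shift] using h1
  · simp only [birkhoffSum, iterate_shift_symm, Function.comp_apply, hint] at h2
    have h3 : ∀ k : ℕ, shiftBy (-((k : ℤ) + 1)) x = shiftBy (-1) (shiftBy (-(k : ℤ)) x) := by
      intro k
      funext j
      simp only [shiftBy]
      congr 1
      ring
    simpa only [h3] using h2

end Shift

/-! Paths of the follow map and equivariance under the shift -/

section Paths

variable {S : Type u} {Ξ : Type w} {M : Type v} (h : S × Ξ → S) (s : S) (x : ℤ → Ξ)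

theorem iterate_follow_fst (n : ℕ) (a : ℤ × S) : ((follow h x)^[n] a).1 = a.1 + n := by
  induction n generalizing a with
  | zero => simp
  | succ n ih =>
    rw [Function.iterate_succ_apply, ih]
    simp only [follow]
    push_cast
    ring

/-- Translation of time by `k`. -/
def translate (S : Type u) (k : ℤ) : ℤ × S ≃ ℤ × S :=
  (Equiv.addRight k).prodCongr (Equiv.refl S)

@[simp] theorem translate_apply (k t : ℤ) (y : S) : translate S k (t, y) = (t + k, y) := rfl

@[simp] theorem translate_fst (k : ℤ) (a : ℤ × S) : (translate S k a).1 = a.1 + k := rfl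

theorem translate_follow (k : ℤ) (a : ℤ × S) :
    translate S k (follow h (shiftBy k x) a) = follow h x (translate S k a) := by
  obtain ⟨t, y⟩ := a
  simp [follow, shiftBy, add_right_comm]

theorem translate_iterate_follow (k : ℤ) (n : ℕ) (a : ℤ × S) :
    translate S k ((follow h (shiftBy k x))^[n] a) = (follow h x)^[n] (translate S k a) :=
  (show Function.Semiconj (translate S k) (follow h (shiftBy k x)) (follow h x) from
    translate_follow h x k).iterate_right n a

theorem translate_mem_bridgeVerts (k : ℤ) (a : ℤ × S) :
    translate S k a ∈ bridgeVerts h s x ↔ a ∈ bridgeVerts h s (shiftBy k x) := by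
  constructor
  · rintro ⟨t, n, hn⟩
    refine ⟨t - k, n, (translate S k).injective ?_⟩
    rw [translate_iterate_follow, ← hn, translate_apply, sub_add_cancel]
  · rintro ⟨t, n, hn⟩
    exact ⟨t + k, n, by rw [← hn, translate_iterate_follow, translate_apply]⟩

theorem translate_mem_windowVerts_singleton (k : ℤ) (a : ℤ × S) :
    translate S k a ∈ windowVerts h s x {k} ↔ a ∈ windowVerts h s (shiftBy k x) {0} := by
  refine and_congr (translate_mem_bridgeVerts h s x k a) ?_
  simp

theorem image_translate_windowVerts (k : ℤ) :
    translate S k '' windowVerts h s (shiftBy k x) {0} = windowVerts h s x {k} := by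
  ext b
  constructor
  · rintro ⟨a, ha, rfl⟩
    exact (translate_mem_windowVerts_singleton h s x k a).2 ha
  · intro hb
    obtain ⟨a, rfl⟩ := (translate S k).surjective b
    exact ⟨a, (translate_mem_windowVerts_singleton h s x k a).1 hb, rfl⟩

theorem arrow_translate (k : ℤ) (a b : ℤ × S) :
    Arrow h s x (translate S k a) (translate S k b) ↔ Arrow h s (shiftBy k x) a b := by
  have h1 : (translate S k b = follow h x (translate S k a)) ↔ b = follow h (shiftBy k x) a := by
    rw [← translate_follow, (translate S k).injective.eq_iff]
  have h2 : (translate S k b = ((translate S k a).1 + 1, s)) ↔ b = (a.1 + 1, s) := by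
    rw [show ((translate S k a).1 + 1, s) = translate S k (a.1 + 1, s) by
      simp [add_right_comm], (translate S k).injective.eq_iff]
  exact or_congr h1 (and_congr Iff.rfl h2)

/-- Vertex marks contain the state and the driving value but not the time, and edge marks depend
only on time differences. Translation is therefore an isomorphism of marked graphs. -/
theorem bridgeClass_translate (mV : S × Ξ → M) (mE : Bool → M) (k : ℤ) (a : ℤ × S) :
    bridgeClass h s mV mE x (translate S k a) = bridgeClass h s mV mE (shiftBy k x) a := by
  refine GStar.ofGraph_equiv (translate S k) (fun a b => ?_) (fun a => rfl) (fun a b => ?_) a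
  · exact and_congr (translate_mem_bridgeVerts h s x k a)
      (and_congr (translate_mem_bridgeVerts h s x k b)
        (or_congr (arrow_translate h s x k a b) (arrow_translate h s x k b a)))
  · simp only [edgeMark, translate_fst]
    congr 2
    simp only [eq_iff_iff]
    omega

/-! Local finiteness, and comparison of the bridge graph with its windows -/

variable {h s x}

theorem windowVerts_eq_biUnion (I : Finset ℤ) :
    windowVerts h s x I = ⋃ t ∈ (I : Set ℤ), windowVerts h s x {t} := by
  ext a
  simp only [windowVerts, Set.mem_iUnion, Finset.mem_singleton, Finset.mem_coe]
  constructor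
  · exact fun ha => ⟨a.1, ha.2, ha.1, rfl⟩
  · rintro ⟨t, ht, ha, rfl⟩
    exact ⟨ha, ht⟩

theorem finite_windowVerts (hx : ∀ t, (windowVerts h s x {t}).Finite) (I : Finset ℤ) :
    (windowVerts h s x I).Finite := by
  rw [windowVerts_eq_biUnion]
  exact I.finite_toSet.biUnion fun t _ => hx t

theorem time_of_adj {a b : ℤ × S} (hab : (spineGraph h s x).Adj a b) :
    b.1 = a.1 + 1 ∨ b.1 = a.1 - 1 := by
  rcases hab.2.2 with hab | hab
  · exact Or.inl hab.time
  · have := hab.time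
    exact Or.inr (by omega)

/-- All neighbours of a vertex lie in the two adjacent slices. -/
theorem spineGraph_locallyFinite (hx : ∀ t, (windowVerts h s x {t}).Finite) (a : ℤ × S) :
    ((spineGraph h s x).neighborSet a).Finite := by
  refine (finite_windowVerts hx {a.1 + 1, a.1 - 1}).subset fun b hb => ⟨hb.2.1, ?_⟩
  simpa using time_of_adj hb

theorem windowGraph_locallyFinite (hx : ∀ t, (windowVerts h s x {t}).Finite) (I : Finset ℤ)
    (a : ℤ × S) : ((windowGraph h s x I).neighborSet a).Finite :=
  (spineGraph_locallyFinite hx a).subset fun _ hb => hb.1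

theorem time_of_mem_nbhd {n : ℕ} {a b : ℤ × S} (hb : b ∈ nbhd (spineGraph h s x) a n) :
    a.1 - n ≤ b.1 ∧ b.1 ≤ a.1 + n := by
  induction n generalizing b with
  | zero => rw [show b = a from hb]; simp
  | succ n ih =>
    obtain ⟨c, hc, rfl | hcb⟩ := hb
    · have := ih hc
      push_cast
      omega
    · have := ih hc
      have := time_of_adj hcb
      push_cast
      omega

/-- Each edge changes time by one, so the `n`-ball stays within time distance `n` and the edges at
its vertices within `n + 1`. -/
theorem ballIso_windowClass (hx : ∀ t, (windowVerts h s x {t}).Finite) (mV : S × Ξ → M)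
    (mE : Bool → M) {I : Finset ℤ} {a : ℤ × S} {n : ℕ}
    (hI : ∀ t, a.1 - (n + 1) ≤ t → t ≤ a.1 + (n + 1) → t ∈ I) :
    GStar.BallIso (fun a b : M => a = b) n (windowClass h s mV mE x I a)
      (bridgeClass h s mV mE x a) := by
  refine (GStar.ballIso_ofGraph (R := fun a b => a = b) (spineGraph_locallyFinite hx)
    (windowGraph_locallyFinite hx I) (fun b hb c => ?_) (fun _ _ => rfl) fun _ _ _ _ => rfl).symm
      fun a b => Eq.symm
  refine ⟨fun hbc => ⟨hbc, ?_, ?_⟩, fun hbc => hbc.1⟩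
  · have := time_of_mem_nbhd hb
    exact hI _ (by omega) (by omega)
  · have := time_of_mem_nbhd hb
    have := time_of_adj hbc
    exact hI _ (by omega) (by omega)

end Paths

section VertexMark

variable {S : Type u} {Ξ : Type w} {M : Type v} [MeasurableSpace S] [MeasurableSpace Ξ]
  [MeasurableSpace M] {mV : S × Ξ → M}

theorem measurable_vertexMark (hmV : Measurable mV) (a : ℤ × S) :
    Measurable fun x : ℤ → Ξ => vertexMark mV x a :=
  hmV.comp (measurable_const.prodMk (measurable_pi_apply a.1))

end VertexMark

/-! ### Measurability of the bridge graph in the driving sequence -/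

section Measurability

variable {S : Type u} {Ξ : Type w} [Countable S] [MeasurableSpace S] [DiscreteMeasurableSpace S]
  [MeasurableSpace Ξ] {h : S × Ξ → S}

theorem measurable_follow (hh : Measurable h) {f : (ℤ → Ξ) → ℤ × S} (hf : Measurable f) :
    Measurable fun x => follow h x (f x) := by
  have : Measurable fun p : (ℤ × S) × (ℤ → Ξ) => follow h p.2 p.1 :=
    measurable_from_prod_countable_right fun a => by
      have h1 : Measurable fun x : ℤ → Ξ => (a.2, x a.1) :=
        measurable_const.prodMk (measurable_pi_apply a.1)
      exact (measurable_const (a := a.1 + 1)).prodMk (hh.comp h1)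
  exact this.comp (hf.prodMk measurable_id)

theorem measurable_iterate_follow (hh : Measurable h) (n : ℕ) (a : ℤ × S) :
    Measurable fun x : ℤ → Ξ => (follow h x)^[n] a := by
  induction n with
  | zero => exact measurable_const
  | succ n ih =>
    simp only [Function.iterate_succ_apply']
    exact measurable_follow hh ih

variable (s : S)

theorem measurableSet_bridgeVerts (hh : Measurable h) (a : ℤ × S) :
    MeasurableSet {x : ℤ → Ξ | a ∈ bridgeVerts h s x} := by
  have : {x : ℤ → Ξ | a ∈ bridgeVerts h s x} =
      ⋃ t : ℤ, ⋃ n : ℕ, (fun x : ℤ → Ξ => (follow h x)^[n] (t, s)) ⁻¹' {a} := by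
    ext x
    simp [bridgeVerts]
  rw [this]
  exact .iUnion fun t => .iUnion fun n =>
    measurable_iterate_follow hh n _ (measurableSet_singleton a)

theorem measurableSet_windowVerts (hh : Measurable h) (I : Finset ℤ) (a : ℤ × S) :
    MeasurableSet {x : ℤ → Ξ | a ∈ windowVerts h s x I} :=
  (measurableSet_bridgeVerts s hh a).inter (.const (a.1 ∈ I))

theorem measurableSet_arrow (hh : Measurable h) (a b : ℤ × S) :
    MeasurableSet {x : ℤ → Ξ | Arrow h s x a b} := by
  have : MeasurableSet ((fun x : ℤ → Ξ => follow h x a) ⁻¹' {b}) :=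
    measurable_follow hh measurable_const (measurableSet_singleton b)
  have h2 : {x : ℤ → Ξ | Arrow h s x a b} = ((fun x : ℤ → Ξ => follow h x a) ⁻¹' {b}) ∪
      {_x | a.2 = s ∧ b = (a.1 + 1, s)} := by
    ext x
    exact or_congr_left eq_comm
  rw [h2]
  exact this.union (.const _)

theorem measurableSet_spineGraph_adj (hh : Measurable h) (a b : ℤ × S) :
    MeasurableSet {x : ℤ → Ξ | (spineGraph h s x).Adj a b} :=
  (measurableSet_bridgeVerts s hh a).inter ((measurableSet_bridgeVerts s hh b).inter
    ((measurableSet_arrow s hh a b).union (measurableSet_arrow s hh b a)))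

theorem measurableSet_windowGraph_adj (hh : Measurable h) (I : Finset ℤ) (a b : ℤ × S) :
    MeasurableSet {x : ℤ → Ξ | (windowGraph h s x I).Adj a b} :=
  (measurableSet_spineGraph_adj s hh a b).inter (.const (a.1 ∈ I ∧ b.1 ∈ I))

variable {M : Type v} [MeasurableSpace M] {mV : S × Ξ → M}

theorem measurable_bridgeClass [MetricSpace M] [TopologicalSpace.SeparableSpace M] [BorelSpace M]
    (hh : Measurable h) (hmV : Measurable mV) (mE : Bool → M) (a : ℤ × S) :
    Measurable fun x : ℤ → Ξ => bridgeClass h s mV mE x a :=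
  GStar.measurable_ofGraph (measurableSet_spineGraph_adj s hh) (measurable_vertexMark hmV) _ a

theorem measurable_windowClass [MetricSpace M] [TopologicalSpace.SeparableSpace M] [BorelSpace M]
    (hh : Measurable h) (hmV : Measurable mV) (mE : Bool → M) (I : Finset ℤ) (a : ℤ × S) :
    Measurable fun x : ℤ → Ξ => windowClass h s mV mE x I a :=
  GStar.measurable_ofGraph (measurableSet_windowGraph_adj s hh I) (measurable_vertexMark hmV) _ a

end Measurability

/-! The expected size of a slice -/

section SliceSize

variable {S : Type u} {Ξ : Type w} {h : S × Ξ → S} {s : S}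

/-- The path started in `s` at time `t` does not return to `s` within the first `n` steps. -/
def NoReturn (h : S × Ξ → S) (s : S) (t : ℤ) (n : ℕ) (x : ℤ → Ξ) : Prop :=
  ∀ m, 0 < m → m ≤ n → ((follow h x)^[m] (t, s)).2 ≠ s

theorem noReturn_shiftBy (k t : ℤ) (n : ℕ) (x : ℤ → Ξ) :
    NoReturn h s t n (shiftBy k x) ↔ NoReturn h s (t + k) n x := by
  refine forall_congr' fun m => forall_congr' fun _ => forall_congr' fun _ => not_congr ?_
  rw [← translate_apply (S := S) k t s, ← translate_iterate_follow]
  exact Iff.rfl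

/-- Each vertex is assigned the least n such that the path from `s` at time -n hits it. A return to
`s` after m ≤ n steps would give the smaller value n - m. -/
theorem encard_windowVerts_le (x : ℤ → Ξ) :
    (windowVerts h s x {0}).encard ≤ {n : ℕ | NoReturn h s (-n) n x}.encard := by
  refine (Set.encard_le_encard ?_).trans
    (Set.encard_image_le (fun n : ℕ => (follow h x)^[n] (-n, s)) _)
  rintro a ⟨⟨t, n, hn⟩, ha⟩
  have ht : t = -n := by
    have := iterate_follow_fst h x n (t, s)
    rw [hn, Finset.mem_singleton.1 ha] at this
    simp only at this
    omega
  subst ht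
  have hex : ∃ n : ℕ, (follow h x)^[n] (-n, s) = a := ⟨n, hn⟩
  classical
  refine ⟨Nat.find hex, fun m hm hmn hreturn => ?_, Nat.find_spec hex⟩
  refine Nat.find_min hex (m := Nat.find hex - m) (by omega) ?_
  have hspec := Nat.find_spec hex
  generalize Nat.find hex = N at hmn hreturn hspec
  rw [show N = (N - m) + m by omega, Function.iterate_add_apply] at hspec
  refine Eq.trans ?_ hspec
  congr 1
  rw [Nat.sub_add_cancel hmn]
  refine Prod.ext ?_ hreturn.symm
  rw [iterate_follow_fst]
  push_cast [hmn]
  ring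

/-- The tail-sum formula: a return after `m` steps leaves at most the terms n < m nonzero. -/
theorem tsum_noReturn_le (x : ℤ → Ξ) :
    ∑' n : ℕ, {x | NoReturn h s 0 n x}.indicator (1 : (ℤ → Ξ) → ℝ≥0∞) x ≤
      timeUntilReturn h x 0 s s := by
  refine le_iInf₂ fun m hm => ?_
  have h0 : ∀ n ∉ Finset.range m,
      {x | NoReturn h s 0 n x}.indicator (1 : (ℤ → Ξ) → ℝ≥0∞) x = 0 := fun n hn => by
    have hmn : m ≤ n := by simpa using hn
    exact Set.indicator_of_notMem (fun hx : NoReturn h s 0 n x => hx m hm.1 hmn hm.2) _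
  rw [tsum_eq_sum h0]
  refine (Finset.sum_le_card_nsmul _ _ 1 fun n _ => ?_).trans (by simp)
  exact Set.indicator_le_self' (by simp) x

variable [Countable S] [MeasurableSpace S] [DiscreteMeasurableSpace S] [MeasurableSpace Ξ]

theorem measurableSet_noReturn (hh : Measurable h) (t : ℤ) (n : ℕ) :
    MeasurableSet {x : ℤ → Ξ | NoReturn h s t n x} := by
  have : {x : ℤ → Ξ | NoReturn h s t n x} = ⋂ m : ℕ, ⋂ _ : 0 < m, ⋂ _ : m ≤ n,
      (fun x : ℤ → Ξ => ((follow h x)^[m] (t, s)).2) ⁻¹' {s}ᶜ := by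
    ext x
    simp [NoReturn]
  rw [this]
  exact .iInter fun m => .iInter fun _ => .iInter fun _ =>
    (measurable_snd.comp (measurable_iterate_follow hh m _)) (measurableSet_singleton s).compl

/-- Stationarity moves the start of the n-th path from time -n to time 0, so that all terms concern
the same return time. -/
theorem lintegral_encard_windowVerts_le {μ : Measure (ℤ → Ξ)} (hμ : Ergodic shift μ)
    (hh : Measurable h) :
    ∫⁻ x, ((windowVerts h s x {0}).encard : ℝ≥0∞) ∂μ ≤ ∫⁻ x, timeUntilReturn h x 0 s s ∂μ := by
  calc ∫⁻ x, ((windowVerts h s x {0}).encard : ℝ≥0∞) ∂μ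
      ≤ ∫⁻ x, ∑' n : ℕ, {x | NoReturn h s (-n) n x}.indicator 1 x ∂μ := by
        refine lintegral_mono fun x => ?_
        refine (ENat.toENNReal_mono (encard_windowVerts_le x)).trans ?_
        rw [← ENNReal.tsum_set_one, tsum_subtype _ fun _ => (1 : ℝ≥0∞)]
        exact le_rfl
    _ = ∑' n : ℕ, ∫⁻ x, {x | NoReturn h s 0 n x}.indicator 1 x ∂μ := by
        rw [lintegral_tsum fun n => (measurable_one.indicator
          (measurableSet_noReturn hh _ _)).aemeasurable]
        refine tsum_congr fun n => ?_
        rw [lintegral_indicator_one (measurableSet_noReturn hh _ _),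
          lintegral_indicator_one (measurableSet_noReturn hh _ _),
          ← (measurePreserving_shiftBy hμ (-(n : ℤ))).measure_preimage
            (measurableSet_noReturn hh 0 n).nullMeasurableSet]
        congr 1
        ext x
        simpa using (noReturn_shiftBy (h := h) (s := s) (-(n : ℤ)) 0 n x).symm
    _ = ∫⁻ x, ∑' n : ℕ, {x | NoReturn h s 0 n x}.indicator 1 x ∂μ :=
        (lintegral_tsum fun n => (measurable_one.indicator
          (measurableSet_noReturn hh _ _)).aemeasurable).symm
    _ ≤ _ := lintegral_mono fun x => tsum_noReturn_le x

end SliceSize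

/-! Sums over slices, and the measure `unimodularMeasure` -/

theorem tsum_coe_eq_finsum {α : Type*} {V : Set α} (hV : V.Finite) (f : α → ℝ≥0) :
    (∑' a : V, (f a : ℝ≥0∞)).toReal = ∑ᶠ a ∈ V, (f a : ℝ) := by
  rw [finsum_mem_eq_finite_toFinset_sum _ hV]
  have := Finset.tsum_subtype' hV.toFinset fun a => (f a : ℝ≥0∞)
  rw [hV.coe_toFinset] at this
  rw [this, ENNReal.toReal_sum fun a _ => ENNReal.coe_ne_top]
  rfl

/-- The vertex `(0, s)` is always present; this keeps the normalising constant away from 0. -/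
theorem one_le_meanSlice {Ω : Type*} [MeasurableSpace Ω] {P : Measure Ω} [IsProbabilityMeasure P]
    {S : Type u} {Ξ : Type w} (ξ : ℤ → Ω → Ξ) (h : S × Ξ → S) (s : S) :
    1 ≤ meanSlice P ξ h s := by
  rw [meanSlice, ← (by simp : ∫⁻ _, 1 ∂P = 1)]
  refine lintegral_mono fun ω => ?_
  have : (0, s) ∈ windowVerts h s (path ξ ω) {0} := ⟨⟨0, 0, rfl⟩, by simp⟩
  rw [← ENat.toENNReal_one]
  exact ENat.toENNReal_mono (Set.one_le_encard_iff_nonempty.2 ⟨_, this⟩)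

section SliceSum

variable {S : Type u} {Ξ : Type w} {M : Type v} (h : S × Ξ → S) (s : S) (mV : S × Ξ → M)
  (mE : Bool → M)

/-- The sum of a function of the rooted network over the roots at time `0`. -/
noncomputable def sliceSum (g : GStar.{u} M → ℝ≥0) (x : ℤ → Ξ) : ℝ≥0∞ :=
  ∑' a : windowVerts h s x {0}, (g (bridgeClass h s mV mE x a) : ℝ≥0∞)

theorem sliceSum_one (x : ℤ → Ξ) :
    sliceSum h s mV mE (fun _ => 1) x = (windowVerts h s x {0}).encard := by
  simp [sliceSum]

theorem sliceSum_le {g : GStar.{u} M → ℝ≥0} {C : ℝ≥0} (hC : ∀ y, g y ≤ C) (x : ℤ → Ξ) :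
    sliceSum h s mV mE g x ≤ (windowVerts h s x {0}).encard * C := by
  rw [← ENNReal.tsum_set_const]
  exact ENNReal.tsum_le_tsum fun a => by exact_mod_cast hC _

variable {h s} in
-- Links the stationary process, to which the ergodic theorem applies, with the actual slices of one
-- realization.
theorem toReal_sliceSum_shiftBy {x : ℤ → Ξ} (hx : ∀ t, (windowVerts h s x {t}).Finite)
    (g : GStar.{u} M → ℝ≥0) (t : ℤ) :
    (sliceSum h s mV mE g (shiftBy t x)).toReal =
      ∑ᶠ a ∈ windowVerts h s x {t}, (g (bridgeClass h s mV mE x a) : ℝ) := by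
  have hfin : (windowVerts h s (shiftBy t x) {0}).Finite := by
    refine Set.Finite.of_finite_image (f := translate S t) ?_ (translate S t).injective.injOn
    rw [image_translate_windowVerts]
    exact hx t
  rw [sliceSum, tsum_coe_eq_finsum hfin fun a => g (bridgeClass h s mV mE (shiftBy t x) a),
    ← image_translate_windowVerts h s x t, finsum_mem_image (translate S t).injective.injOn]
  simp only [bridgeClass_translate]

variable {Ω : Type*} [MeasurableSpace Ω] [Countable S] [MeasurableSpace S]
  [DiscreteMeasurableSpace S] [MeasurableSpace Ξ]

section

variable {h} in
-- The random index set is traded for indicators in a sum over all of the countable set `ℤ × S`.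
theorem measurable_tsum_windowVerts (hh : Measurable h) {φ : (ℤ → Ξ) → ℤ × S → ℝ≥0∞}
    (hφ : ∀ a, Measurable fun x => φ x a) :
    Measurable fun x => ∑' a : windowVerts h s x {0}, φ x a := by
  have : (fun x => ∑' a : windowVerts h s x {0}, φ x a) =
      fun x => ∑' a, {x | a ∈ windowVerts h s x {0}}.indicator (fun x => φ x a) x := by
    funext x
    rw [tsum_subtype _ (φ x)]
    rfl
  rw [this]
  exact Measurable.tsum fun a =>
    (hφ a).indicator (measurableSet_windowVerts s hh {0} a)

end

variable [MetricSpace M] [TopologicalSpace.SeparableSpace M] [MeasurableSpace M] [BorelSpace M]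
  {h mV}

theorem measurable_sliceSum (hh : Measurable h) (hmV : Measurable mV) {g : GStar.{u} M → ℝ≥0}
    (hg : Measurable g) : Measurable (sliceSum h s mV mE g) :=
  measurable_tsum_windowVerts s hh fun a =>
    (hg.comp (measurable_bridgeClass s hh hmV mE a)).coe_nnreal_ennreal

theorem measurable_sliceMeasure (hh : Measurable h) (hmV : Measurable mV) :
    Measurable fun x : ℤ → Ξ => Measure.sum fun w : windowVerts h s x {0} =>
      Measure.dirac (bridgeClass h s mV mE x w) := by
  refine Measure.measurable_of_measurable_coe _ fun A hA => ?_
  simp only [Measure.sum_apply _ hA, Measure.dirac_apply' _ hA]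
  exact measurable_tsum_windowVerts s hh
    (φ := fun x a => A.indicator 1 (bridgeClass h s mV mE x a)) fun a =>
      (measurable_one.indicator hA).comp (measurable_bridgeClass s hh hmV mE a)

variable {P : Measure Ω} {ξ : ℤ → Ω → Ξ}

theorem measurable_path (hξ : ∀ t, Measurable (ξ t)) : Measurable (path ξ) :=
  measurable_pi_lambda _ hξ

theorem lintegral_unimodularMeasure (hh : Measurable h) (hmV : Measurable mV)
    (hξ : ∀ t, Measurable (ξ t)) {g : GStar.{u} M → ℝ≥0} (hg : Measurable g) :
    ∫⁻ y, g y ∂unimodularMeasure P ξ h s mV mE =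
      (meanSlice P ξ h s)⁻¹ * ∫⁻ x, sliceSum h s mV mE g x ∂P.map (path ξ) := by
  have hmeas : Measurable fun ω => Measure.sum fun w : windowVerts h s (path ξ ω) {0} =>
      Measure.dirac (bridgeClass h s mV mE (path ξ ω) w) :=
    (measurable_sliceMeasure s mE hh hmV).comp (measurable_path hξ)
  rw [unimodularMeasure, lintegral_smul_measure,
    Measure.lintegral_bind hmeas.aemeasurable hg.coe_nnreal_ennreal.aemeasurable,
    lintegral_map (measurable_sliceSum s mE hh hmV hg) (measurable_path hξ), smul_eq_mul]
  congr 1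
  refine lintegral_congr fun ω => ?_
  rw [lintegral_sum_measure]
  exact tsum_congr fun a => lintegral_dirac' _ hg.coe_nnreal_ennreal

theorem measurable_encard_windowVerts (hh : Measurable h) :
    Measurable fun x : ℤ → Ξ => ((windowVerts h s x {0}).encard : ℝ≥0∞) := by
  simp only [← ENNReal.tsum_set_one]
  exact measurable_tsum_windowVerts s hh fun _ => measurable_const

theorem meanSlice_eq (hh : Measurable h) (hξ : ∀ t, Measurable (ξ t)) :
    meanSlice P ξ h s = ∫⁻ x, ((windowVerts h s x {0}).encard : ℝ≥0∞) ∂P.map (path ξ) :=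
  (lintegral_map (measurable_encard_windowVerts s hh) (measurable_path hξ)).symm

theorem measurable_timeUntilReturn (hh : Measurable h) :
    Measurable fun x : ℤ → Ξ => timeUntilReturn h x 0 s s := by
  refine Measurable.iInf fun n => ?_
  have hm : MeasurableSet {x : ℤ → Ξ | 0 < n ∧ ((follow h x)^[n] (0, s)).2 = s} :=
    (MeasurableSet.const (0 < n)).inter
      ((measurable_snd.comp (measurable_iterate_follow hh n _)) (measurableSet_singleton s))
  classical
  have : (fun x : ℤ → Ξ => ⨅ _ : 0 < n ∧ ((follow h x)^[n] (0, s)).2 = s, (n : ℝ≥0∞)) =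
      fun x => if 0 < n ∧ ((follow h x)^[n] (0, s)).2 = s then (n : ℝ≥0∞) else ⊤ := by
    funext x
    split_ifs with hx <;> simp [hx]
  rw [this]
  exact Measurable.ite hm measurable_const measurable_const

theorem meanSlice_lt_top (hh : Measurable h) (hξ : ∀ t, Measurable (ξ t))
    (hξerg : IsStationaryErgodic P ξ) (hs : IsPositiveRecurrent P ξ h s) :
    meanSlice P ξ h s < ∞ := by
  rw [meanSlice_eq s hh hξ]
  refine (lintegral_encard_windowVerts_le hξerg hh).trans_lt ?_
  rw [lintegral_map (measurable_timeUntilReturn s hh) (measurable_path hξ)]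
  exact hs

theorem isProbabilityMeasure_unimodularMeasure [IsProbabilityMeasure P] (hh : Measurable h)
    (hmV : Measurable mV) (hξ : ∀ t, Measurable (ξ t)) (hξerg : IsStationaryErgodic P ξ)
    (hs : IsPositiveRecurrent P ξ h s) :
    IsProbabilityMeasure (unimodularMeasure P ξ h s mV mE) := by
  refine ⟨?_⟩
  have h1 := lintegral_unimodularMeasure (P := P) (g := fun _ => 1) s mE hh hmV hξ
    measurable_const
  simp only [sliceSum_one, ENNReal.coe_one, lintegral_one] at h1
  rw [h1, ← meanSlice_eq s hh hξ]
  exact ENNReal.inv_mul_cancel (zero_lt_one.trans_le (one_le_meanSlice ξ h s)).ne'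
    (meanSlice_lt_top s hh hξ hξerg hs).ne

theorem integral_unimodularMeasure (hh : Measurable h) (hmV : Measurable mV)
    (hξ : ∀ t, Measurable (ξ t)) {g : GStar.{u} M → ℝ≥0} (hg : Measurable g) :
    ∫ y, (g y : ℝ) ∂unimodularMeasure P ξ h s mV mE =
      (∫⁻ x, sliceSum h s mV mE g x ∂P.map (path ξ)).toReal / (meanSlice P ξ h s).toReal := by
  rw [integral_eq_lintegral_of_nonneg_ae (ae_of_all _ fun y => (g y).coe_nonneg)
    (measurable_coe_nnreal_real.comp hg).aestronglyMeasurable]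
  simp only [ENNReal.ofReal_coe_nnreal]
  rw [lintegral_unimodularMeasure s mE hh hmV hξ hg, ENNReal.toReal_mul, ENNReal.toReal_inv,
    inv_mul_eq_div]

theorem ae_finite_windowVerts {μ : Measure (ℤ → Ξ)} (hμ : Ergodic shift μ) (hh : Measurable h)
    (hfin : ∫⁻ x, ((windowVerts h s x {0}).encard : ℝ≥0∞) ∂μ ≠ ∞) :
    ∀ᵐ x ∂μ, ∀ t, (windowVerts h s x {t}).Finite := by
  refine ae_all_iff.2 fun t => ?_
  have h0 := ae_lt_top (measurable_encard_windowVerts s hh) hfin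
  filter_upwards [(measurePreserving_shiftBy hμ t).quasiMeasurePreserving.ae h0] with x hx
  rw [← image_translate_windowVerts]
  refine Set.Finite.image _ (Set.encard_lt_top_iff.1 ?_)
  exact_mod_cast hx

theorem ae_hasMean_sliceSum {μ : Measure (ℤ → Ξ)} [IsProbabilityMeasure μ]
    (hμ : Ergodic shift μ) (hh : Measurable h) (hmV : Measurable mV)
    (hfin : ∫⁻ x, ((windowVerts h s x {0}).encard : ℝ≥0∞) ∂μ ≠ ∞)
    {g : GStar.{u} M → ℝ≥0} (hg : Measurable g) {C : ℝ≥0} (hC : ∀ y, g y ≤ C) :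
    ∀ᵐ x ∂μ, HasMean (fun t => (sliceSum h s mV mE g (shiftBy t x)).toReal)
      (∫⁻ x, sliceSum h s mV mE g x ∂μ).toReal := by
  have hm := measurable_sliceSum s mE hh hmV hg
  have hlt : ∫⁻ x, sliceSum h s mV mE g x ∂μ ≠ ∞ := by
    refine ((lintegral_mono (sliceSum_le h s mV mE hC)).trans_lt ?_).ne
    rw [lintegral_mul_const _ (measurable_encard_windowVerts s hh)]
    exact ENNReal.mul_lt_top hfin.lt_top ENNReal.coe_lt_top
  rw [← integral_toReal hm.aemeasurable (ae_lt_top hm hlt)]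
  exact ae_hasMean (f := fun x => (sliceSum h s mV mE g x).toReal) hμ hm.ennreal_toReal
    (integrable_toReal_of_lintegral_ne_top hm.aemeasurable hlt)

end SliceSum

/-! Averages over windows -/

section Averages

variable {S : Type u} {Ξ : Type w} {M : Type v} {h : S × Ξ → S} {s : S} {x : ℤ → Ξ}

theorem finsum_windowVerts (hx : ∀ t, (windowVerts h s x {t}).Finite) (I : Finset ℤ)
    (φ : ℤ × S → ℝ) :
    ∑ᶠ a ∈ windowVerts h s x I, φ a = ∑ t ∈ I, ∑ᶠ a ∈ windowVerts h s x {t}, φ a := by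
  rw [windowVerts_eq_biUnion, finsum_mem_biUnion ?_ I.finite_toSet fun t _ => hx t,
    finsum_mem_coe_finset]
  intro t _ t' _ htt'
  refine Set.disjoint_left.2 fun a ha ha' => htt' ?_
  rw [← Finset.mem_singleton.1 ha.2, ← Finset.mem_singleton.1 ha'.2]

theorem finsum_mem_one_eq_ncard {α : Type*} {V : Set α} (hV : V.Finite) :
    ∑ᶠ _a ∈ V, (1 : ℝ) = V.ncard := by
  rw [finsum_mem_eq_finite_toFinset_sum _ hV, Set.ncard_eq_toFinset_card _ hV]
  simp

theorem abs_finsum_sub_finsum_le {α : Type*} {V : Set α} (hV : V.Finite) {φ ψ : α → ℝ} {c : ℝ}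
    (hc : ∀ a ∈ V, |φ a - ψ a| ≤ c) :
    |∑ᶠ a ∈ V, φ a - ∑ᶠ a ∈ V, ψ a| ≤ c * ∑ᶠ _a ∈ V, (1 : ℝ) := by
  simp only [finsum_mem_eq_finite_toFinset_sum _ hV, ← Finset.sum_sub_distrib]
  refine (Finset.abs_sum_le_sum_abs _ _).trans ?_
  rw [Finset.mul_sum]
  exact Finset.sum_le_sum fun a ha => by rw [mul_one]; exact hc a (hV.mem_toFinset.1 ha)

/-- The sum over a window differs little from the sum of the slices of the bridge graph. -/
theorem abs_finsum_windowClass_sub_le (hx : ∀ t, (windowVerts h s x {t}).Finite)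
    (mV : S × Ξ → M) (mE : Bool → M) {g : GStar.{u} M → ℝ≥0} {C : ℝ≥0} (hC : ∀ y, g y ≤ C)
    {ε : ℝ} (hε : 0 ≤ ε) {N : ℕ}
    (hg : ∀ y z, GStar.BallIso (fun a b : M => a = b) N y z → |(g y : ℝ) - g z| ≤ ε) (a b : ℤ) :
    |∑ᶠ v ∈ windowVerts h s x (Finset.Ico a b),
        (g (windowClass h s mV mE x (Finset.Ico a b) v) : ℝ) -
      ∑ t ∈ Finset.Ico a b, ∑ᶠ v ∈ windowVerts h s x {t}, (g (bridgeClass h s mV mE x v) : ℝ)| ≤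
    ε * ∑ t ∈ Finset.Ico a b, ∑ᶠ _v ∈ windowVerts h s x {t}, (1 : ℝ) +
      C * (∑ t ∈ Finset.Ico a b, ∑ᶠ _v ∈ windowVerts h s x {t}, (1 : ℝ) -
        ∑ t ∈ Finset.Ico (a + (N + 1)) (b - (N + 1)), ∑ᶠ _v ∈ windowVerts h s x {t}, (1 : ℝ)) := by
  set I := Finset.Ico a b with hI
  -- Times whose roots have the same `N`-ball in the window as in the whole graph. For a short
  -- window `J` is empty and the estimate is the crude one.
  set J := Finset.Ico (a + (N + 1)) (b - (N + 1)) with hJ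
  have hJI : J ⊆ I := by
    intro t ht
    simp only [hI, hJ, Finset.mem_Ico] at ht ⊢
    omega
  have hite : ∑ t ∈ J, ∑ᶠ _v ∈ windowVerts h s x {t}, (1 : ℝ) =
      ∑ t ∈ I, if t ∈ J then ∑ᶠ _v ∈ windowVerts h s x {t}, (1 : ℝ) else 0 := by
    rw [Finset.sum_ite_mem, Finset.inter_eq_right.2 hJI]
  rw [finsum_windowVerts hx, ← Finset.sum_sub_distrib, hite, ← Finset.sum_sub_distrib,
    Finset.mul_sum, Finset.mul_sum, ← Finset.sum_add_distrib]
  refine (Finset.abs_sum_le_sum_abs _ _).trans (Finset.sum_le_sum fun t ht => ?_)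
  have hn : (0 : ℝ) ≤ ∑ᶠ _v ∈ windowVerts h s x {t}, (1 : ℝ) := by
    rw [finsum_mem_one_eq_ncard (hx t)]
    positivity
  -- An inner slice costs `ε` per vertex; a boundary slice costs `C` per vertex, since both values
  -- lie in [0, C].
  by_cases htJ : t ∈ J
  · rw [if_pos htJ, sub_self, mul_zero, add_zero]
    refine abs_finsum_sub_finsum_le (hx t) fun v hv => hg _ _ (ballIso_windowClass hx mV mE ?_)
    intro t' h1 h2
    have hvt : v.1 = t := Finset.mem_singleton.1 hv.2
    simp only [hI, hJ, Finset.mem_Ico] at htJ ⊢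
    omega
  · rw [if_neg htJ, sub_zero]
    refine (abs_finsum_sub_finsum_le (hx t) (c := C) fun v _ => ?_).trans
      (le_add_of_nonneg_left (mul_nonneg hε hn))
    have h1 : ∀ y, (g y : ℝ) ≤ C := fun y => by exact_mod_cast hC y
    exact abs_sub_le_of_nonneg_of_le (NNReal.coe_nonneg _) (h1 _) (NNReal.coe_nonneg _) (h1 _)

end Averages

/-! Intervals that grow to infinite length -/

section Intervals

theorem exists_eq_Ico {I : Finset ℤ} (hI : (I : Set ℤ).OrdConnected) :
    ∃ a b : ℤ, a ≤ b ∧ I = Finset.Ico a b := by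
  rcases I.eq_empty_or_nonempty with rfl | hne
  · exact ⟨0, 0, le_rfl, by simp⟩
  · refine ⟨I.min' hne, I.max' hne + 1, ?_, ?_⟩
    · have := I.min'_le_max' hne
      omega
    · ext t
      rw [Finset.mem_Ico]
      constructor
      · intro ht
        have h1 := I.min'_le t ht
        have h2 := I.le_max' t ht
        omega
      · rintro ⟨h1, h2⟩
        exact hI.out (Finset.mem_coe.2 (I.min'_mem hne)) (Finset.mem_coe.2 (I.max'_mem hne))
          ⟨h1, by omega⟩

/-- Strict growth forces at least n elements in the n-th interval. The interval with index 1 is thus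
nonempty, and any of its points lies in all later ones, which bounds the drift. -/
theorem exists_endpoints {I : ℕ → Finset ℤ} (hI : ∀ n, (I n : Set ℤ).OrdConnected)
    (hmono : StrictMono I) :
    ∃ (a b : ℕ → ℤ) (K : ℤ), (∀ n, I n = Finset.Ico (a n) (b n)) ∧
      (∀ᶠ n in atTop, a n ≤ K) ∧ (∀ᶠ n in atTop, -K ≤ b n) ∧
      Tendsto (fun n => b n - a n) atTop atTop := by
  choose a b hab hIab using fun n => exists_eq_Ico (hI n)
  have hcard : ∀ n, n ≤ (I n).card := fun n =>
    (Finset.card_strictMono.comp hmono).le_apply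
  obtain ⟨c, hc⟩ : (I 1).Nonempty := Finset.card_pos.1 (hcard 1)
  have hcn : ∀ᶠ n in atTop, a n ≤ c ∧ c < b n := by
    filter_upwards [eventually_ge_atTop 1] with n hn
    have := hmono.monotone hn hc
    rwa [hIab n, Finset.mem_Ico] at this
  refine ⟨a, b, |c|, hIab, ?_, ?_, ?_⟩
  · filter_upwards [hcn] with n hn
    exact hn.1.trans (le_abs_self c)
  · filter_upwards [hcn] with n hn
    exact (neg_abs_le c).trans hn.2.le
  · refine tendsto_atTop_mono (fun n => ?_) tendsto_natCast_atTop_atTop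
    have := hcard n
    rw [hIab n, Int.card_Ico] at this
    have := hab n
    omega

/-- Makes the boundary slices negligible without any bound on single terms: full and shrunken sums
have the same limit after division by the full length. -/
theorem HasMean.tendsto_shrink {u : ℤ → ℝ} {ℓ : ℝ} (hu : HasMean u ℓ) {a b : ℕ → ℤ} {K : ℤ}
    (ha : ∀ᶠ n in atTop, a n ≤ K) (hb : ∀ᶠ n in atTop, -K ≤ b n)
    (hlen : Tendsto (fun n => b n - a n) atTop atTop) (N : ℕ) :
    Tendsto (fun n => (∑ t ∈ Finset.Ico (a n + (N + 1)) (b n - (N + 1)), u t) /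
      ((b n : ℝ) - a n)) atTop (𝓝 ℓ) := by
  have hlen' : Tendsto (fun n => (b n - (N + 1)) - (a n + (N + 1))) atTop atTop := by
    refine (tendsto_atTop_add_const_right _ (-(2 * ((N : ℤ) + 1))) hlen).congr fun n => ?_
    ring
  have h1 := hu.tendsto (a := fun n => a n + (N + 1)) (b := fun n => b n - (N + 1))
    (K := K + (N + 1)) (by filter_upwards [ha] with n hn; omega)
    (by filter_upwards [hb] with n hn; omega) hlen'
  have hreal : Tendsto (fun n => (b n : ℝ) - a n) atTop atTop :=
    (tendsto_intCast_atTop_atTop.comp hlen).congr fun n => by simp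
  have h2 : Tendsto (fun n => 1 - (2 * ((N : ℝ) + 1)) / ((b n : ℝ) - a n)) atTop (𝓝 (1 - 0)) :=
    tendsto_const_nhds.sub (tendsto_const_nhds.div_atTop hreal)
  have h3 := h1.mul h2
  rw [sub_zero, mul_one] at h3
  refine h3.congr' ?_
  filter_upwards [hreal.eventually_gt_atTop (2 * ((N : ℝ) + 1))] with n hn
  have hpos : (0 : ℝ) < 2 * ((N : ℝ) + 1) := by positivity
  push_cast
  have e1 : (b n : ℝ) - a n ≠ 0 := by linarith
  have e2 : (b n : ℝ) - (N + 1) - (a n + (N + 1)) ≠ 0 := by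
    intro h0
    linarith
  have e3 : 1 - 2 * ((N : ℝ) + 1) / ((b n : ℝ) - a n) =
      ((b n : ℝ) - (N + 1) - (a n + (N + 1))) / ((b n : ℝ) - a n) := by
    field_simp
    ring
  rw [e3, div_mul_div_comm, mul_comm ((b n : ℝ) - (N + 1) - (a n + (N + 1))),
    mul_div_mul_right _ _ e2]

end Intervals

/-! ### Convergence of the window averages -/

section Averages

variable {S : Type u} {Ξ : Type w} {M : Type v} {h : S × Ξ → S} {s : S} {x : ℤ → Ξ}

/-- `g` is a uniform limit of functions that depend only on a neighbourhood of the root. -/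
def IsAlmostLocal (g : GStar.{u} M → ℝ≥0) : Prop :=
  ∀ ε : ℝ, 0 < ε → ∃ N : ℕ, ∀ y z,
    GStar.BallIso (fun a b : M => a = b) N y z → |(g y : ℝ) - g z| ≤ ε

theorem tendsto_average (hx : ∀ t, (windowVerts h s x {t}).Finite) (mV : S × Ξ → M)
    (mE : Bool → M) {g : GStar.{u} M → ℝ≥0} {C : ℝ≥0} (hC : ∀ y, g y ≤ C) (hg : IsAlmostLocal g)
    {m ℓ : ℝ} (hm : 0 < m)
    (hone : HasMean (fun t => ∑ᶠ _v ∈ windowVerts h s x {t}, (1 : ℝ)) m)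
    (hsum : HasMean
      (fun t => ∑ᶠ v ∈ windowVerts h s x {t}, (g (bridgeClass h s mV mE x v) : ℝ)) ℓ)
    {I : ℕ → Finset ℤ} (hI : ∀ n, (I n : Set ℤ).OrdConnected) (hmono : StrictMono I) :
    Tendsto (fun n => (∑ᶠ a ∈ windowVerts h s x (I n), (g (windowClass h s mV mE x (I n) a) : ℝ)) /
      ((windowVerts h s x (I n)).ncard : ℝ)) atTop (𝓝 (ℓ / m)) := by
  obtain ⟨a, b, K, hIab, ha, hb, hlen⟩ := exists_endpoints hI hmono
  simp only [hIab]
  set A : ℕ → ℝ := fun n => ∑ᶠ v ∈ windowVerts h s x (Finset.Ico (a n) (b n)),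
    (g (windowClass h s mV mE x (Finset.Ico (a n) (b n)) v) : ℝ) with hA
  have hreal : Tendsto (fun n => (b n : ℝ) - a n) atTop atTop :=
    (tendsto_intCast_atTop_atTop.comp hlen).congr fun n => by simp
  have hD := hone.tendsto ha hb hlen
  have hB := hsum.tendsto ha hb hlen
  have hAB : Tendsto (fun n => A n / ((b n : ℝ) - a n) - (∑ t ∈ Finset.Ico (a n) (b n),
      ∑ᶠ v ∈ windowVerts h s x {t}, (g (bridgeClass h s mV mE x v) : ℝ)) / ((b n : ℝ) - a n))
      atTop (𝓝 0) := by
    rw [Metric.tendsto_nhds]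
    intro δ hδ
    -- There are asymptotically `m` vertices per unit of time, so the inner slices contribute δ/2 in
    -- the limit and the boundary contributes nothing.
    obtain ⟨N, hN⟩ := hg (δ / (2 * m)) (by positivity)
    have hE := hone.tendsto_shrink ha hb hlen N
    have hlim := (hD.const_mul (δ / (2 * m))).add ((hD.sub hE).const_mul (C : ℝ))
    have hlt : δ / (2 * m) * m + C * (m - m) < δ := by
      rw [sub_self, mul_zero, add_zero]
      field_simp
      linarith
    filter_upwards [hlim.eventually_lt_const hlt, hreal.eventually_gt_atTop 0] with n hn hpos
    rw [dist_zero_right, Real.norm_eq_abs, ← sub_div, abs_div, abs_of_pos hpos]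
    refine lt_of_le_of_lt ?_ hn
    rw [div_le_iff₀ hpos]
    refine (abs_finsum_windowClass_sub_le hx mV mE hC (by positivity) hN (a n) (b n)).trans
      (le_of_eq ?_)
    field_simp
  have hAlim := hAB.add hB
  simp only [sub_add_cancel, zero_add] at hAlim
  refine (hAlim.div hD hm.ne').congr' ?_
  filter_upwards [hreal.eventually_gt_atTop 0] with n hpos
  rw [Pi.div_apply, div_div_div_cancel_right₀ hpos.ne', ← finsum_windowVerts hx,
    finsum_mem_one_eq_ncard (finite_windowVerts hx _)]

variable {Ω : Type*} [MeasurableSpace Ω] [Countable S] [MeasurableSpace S]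
  [DiscreteMeasurableSpace S] [MeasurableSpace Ξ] [MetricSpace M]
  [TopologicalSpace.SeparableSpace M] [MeasurableSpace M] [BorelSpace M] {mV : S × Ξ → M}
  {P : Measure Ω} {ξ : ℤ → Ω → Ξ}

theorem ae_finite_windowVerts_path (hh : Measurable h) (hξ : ∀ t, Measurable (ξ t))
    (hξerg : IsStationaryErgodic P ξ) (hs : IsPositiveRecurrent P ξ h s) :
    ∀ᵐ ω ∂P, ∀ t, (windowVerts h s (path ξ ω) {t}).Finite := by
  refine ae_of_ae_map (measurable_path hξ).aemeasurable (ae_finite_windowVerts s hξerg hh ?_)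
  rw [← meanSlice_eq s hh hξ]
  exact (meanSlice_lt_top s hh hξ hξerg hs).ne

theorem ae_tendsto_average [IsProbabilityMeasure P] (hh : Measurable h) (hmV : Measurable mV)
    (mE : Bool → M) (hξ : ∀ t, Measurable (ξ t)) (hξerg : IsStationaryErgodic P ξ)
    (hs : IsPositiveRecurrent P ξ h s) {I : ℕ → Finset ℤ}
    (hI : ∀ n, (I n : Set ℤ).OrdConnected) (hmono : StrictMono I) {g : GStar.{u} M → ℝ≥0}
    (hgm : Measurable g) {C : ℝ≥0} (hC : ∀ y, g y ≤ C) (hg : IsAlmostLocal g) :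
    ∀ᵐ ω ∂P, Tendsto
      (fun n => (∑ᶠ a ∈ windowVerts h s (path ξ ω) (I n),
          (g (windowClass h s mV mE (path ξ ω) (I n) a) : ℝ)) /
        ((windowVerts h s (path ξ ω) (I n)).ncard : ℝ))
      atTop (𝓝 (∫ y, (g y : ℝ) ∂unimodularMeasure P ξ h s mV mE)) := by
  have := Measure.isProbabilityMeasure_map (μ := P) (measurable_path hξ).aemeasurable
  have hlt := meanSlice_lt_top s hh hξ hξerg hs
  have hfin := hlt.ne
  rw [meanSlice_eq s hh hξ] at hfin
  have h1 := ae_hasMean_sliceSum (mV := mV) (g := fun _ => 1) s mE hξerg hh hmV hfin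
    measurable_const (C := 1) fun _ => le_rfl
  have e1 : ∫⁻ x, sliceSum h s mV mE (fun _ => 1) x ∂P.map (path ξ) = meanSlice P ξ h s := by
    simp only [sliceSum_one, meanSlice_eq s hh hξ]
  rw [e1] at h1
  have h2 := ae_hasMean_sliceSum s mE hξerg hh hmV hfin hgm hC
  rw [integral_unimodularMeasure s mE hh hmV hξ hgm]
  filter_upwards [ae_of_ae_map (measurable_path hξ).aemeasurable h1,
    ae_of_ae_map (measurable_path hξ).aemeasurable h2,
    ae_finite_windowVerts_path hh hξ hξerg hs] with ω h1 h2 hx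
  simp only [toReal_sliceSum_shiftBy mV mE hx, NNReal.coe_one] at h1 h2
  exact tendsto_average hx mV mE hC hg
    (ENNReal.toReal_pos (zero_lt_one.trans_le (one_le_meanSlice ξ h s)).ne' hlt.ne) h1 h2 hI hmono

end Averages

/-! Uniformly chosen roots -/

theorem GStar.ofGraph_congr {W : Type u} {M : Type v} {G : SimpleGraph W} {vm vm' : W → M}
    (em : W → W → M) {o : W} (hvm : ∀ a, G.Reachable o a → vm a = vm' a) :
    ofGraph G vm em o = ofGraph G vm' em o := by
  by_cases hG : ∀ a, (G.neighborSet a).Finite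
  · rw [ofGraph_of_finite hG, ofGraph_of_finite hG]
    have : (fun a : (G.connectedComponentMk o).supp => vm a) =
        fun a : (G.connectedComponentMk o).supp => vm' a :=
      funext fun a => hvm a (SimpleGraph.ConnectedComponent.eq.1 a.2).symm
    simp only [component, this]
  · simp only [ofGraph, dif_neg hG, hvm o (SimpleGraph.Reachable.refl o)]

/-! ### The information contained in the restricted graph -/

section WindowSigma

variable {Ω : Type*} {S : Type u} {Ξ : Type w} {M : Type v} {h : S × Ξ → S} {s : S}
  {ξ : ℤ → Ω → Ξ} {mV : S × Ξ → M} {mE : Bool → M} {I : Finset ℤ}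

/-- The mark of a vertex of the window, with a default value for all other vertices. -/
noncomputable def erasedMark (h : S × Ξ → S) (s : S) (mV : S × Ξ → M) (m₀ : M) (x : ℤ → Ξ)
    (I : Finset ℤ) (a : ℤ × S) : M :=
  open Classical in if a ∈ windowVerts h s x I then vertexMark mV x a else m₀

theorem mem_windowVerts_of_reachable {x : ℤ → Ξ} {a b : ℤ × S} (ha : a ∈ windowVerts h s x I)
    (hab : (windowGraph h s x I).Reachable a b) : b ∈ windowVerts h s x I := by
  obtain ⟨p⟩ := hab
  induction p with
  | nil => exact ha
  | cons hadj _ ih => exact ih ⟨hadj.1.2.1, hadj.2.2⟩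

/-- The σ-algebra `windowSigma` does not see marks outside the window. The component of a window
vertex stays in the window, so erasing those marks changes nothing and yields a version measurable
for `windowSigma`. -/
theorem windowClass_eq_erasedMark (m₀ : M) {x : ℤ → Ξ} {a : ℤ × S}
    (ha : a ∈ windowVerts h s x I) : windowClass h s mV mE x I a =
      GStar.ofGraph (windowGraph h s x I) (erasedMark h s mV m₀ x I) (edgeMark mE) a :=
  GStar.ofGraph_congr _ fun _ hb => (if_pos (mem_windowVerts_of_reachable ha hb)).symm

variable [MeasurableSpace M]

theorem windowSigma_measurableSet_mem (a : ℤ × S) :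
    MeasurableSet[windowSigma ξ h s mV mE I] {ω | a ∈ windowVerts h s (path ξ ω) I} :=
  MeasurableSpace.measurableSet_generateFrom (Or.inl ⟨a, Set.univ, .univ, by simp⟩)

theorem windowSigma_measurable_erasedMark (m₀ : M) (a : ℤ × S) :
    Measurable[windowSigma ξ h s mV mE I] fun ω => erasedMark h s mV m₀ (path ξ ω) I a := by
  intro A hA
  have : (fun ω => erasedMark h s mV m₀ (path ξ ω) I a) ⁻¹' A =
      {ω | a ∈ windowVerts h s (path ξ ω) I ∧ vertexMark mV (path ξ ω) a ∈ A} ∪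
        ({ω | a ∈ windowVerts h s (path ξ ω) I}ᶜ ∩ {_ω | m₀ ∈ A}) := by
    ext ω
    by_cases ha : a ∈ windowVerts h s (path ξ ω) I <;> simp [erasedMark, ha]
  rw [this]
  refine MeasurableSet.union (MeasurableSpace.measurableSet_generateFrom (Or.inl ⟨a, A, hA, rfl⟩))
    ((windowSigma_measurableSet_mem a).compl.inter (.const _))

theorem windowSigma_measurable_ofGraph [MetricSpace M] [TopologicalSpace.SeparableSpace M]
    [BorelSpace M] [Countable S] (m₀ : M) (a : ℤ × S) :
    Measurable[windowSigma ξ h s mV mE I] fun ω =>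
      GStar.ofGraph (windowGraph h s (path ξ ω) I) (erasedMark h s mV m₀ (path ξ ω) I)
        (edgeMark mE) a := by
  let _ : MeasurableSpace Ω := windowSigma ξ h s mV mE I
  refine GStar.measurable_ofGraph (fun b c => ?_) (windowSigma_measurable_erasedMark m₀) _ a
  exact MeasurableSpace.measurableSet_generateFrom (Or.inr ⟨b, c, Set.univ, .univ, by simp⟩)

variable [MeasurableSpace Ω] [Countable S] [MeasurableSpace S] [DiscreteMeasurableSpace S]
  [MeasurableSpace Ξ]

theorem windowSigma_le (hh : Measurable h) (hmV : Measurable mV) (hξ : ∀ t, Measurable (ξ t)) :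
    windowSigma ξ h s mV mE I ≤ ‹MeasurableSpace Ω› := by
  refine MeasurableSpace.generateFrom_le ?_
  rintro _ (⟨a, A, hA, rfl⟩ | ⟨a, b, A, -, rfl⟩)
  · exact measurable_path hξ
      ((measurableSet_windowVerts s hh I a).inter (measurable_vertexMark hmV a hA))
  · exact measurable_path hξ
      ((measurableSet_windowGraph_adj s hh I a b).inter (.const (edgeMark mE a b ∈ A)))

end WindowSigma

section RootDensity

variable {S : Type u} {Ξ : Type w} {h : S × Ξ → S} {s : S} {I : Finset ℤ}

/-- The conditional probability that the root is `a`. -/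
noncomputable def rootDensity (h : S × Ξ → S) (s : S) (I : Finset ℤ) (a : ℤ × S) (x : ℤ → Ξ) :
    ℝ≥0∞ :=
  (windowVerts h s x I).indicator (fun _ => ((windowVerts h s x I).encard : ℝ≥0∞)⁻¹) a

theorem tsum_rootDensity_eq {x : ℤ → Ξ} (hx : (windowVerts h s x I).Finite)
    (f : ℤ × S → ℝ≥0) :
    (∑' a, rootDensity h s I a x * f a).toReal =
      (∑ᶠ a ∈ windowVerts h s x I, (f a : ℝ)) / ((windowVerts h s x I).ncard : ℝ) := by
  have h1 : ∀ a, rootDensity h s I a x * f a = ((windowVerts h s x I).encard : ℝ≥0∞)⁻¹ *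
      (windowVerts h s x I).indicator (fun a => (f a : ℝ≥0∞)) a := fun a => by
    by_cases ha : a ∈ windowVerts h s x I
    · rw [rootDensity, Set.indicator_of_mem ha, Set.indicator_of_mem ha]
    · rw [rootDensity, Set.indicator_of_notMem ha, Set.indicator_of_notMem ha, zero_mul, mul_zero]
  simp only [h1]
  rw [ENNReal.tsum_mul_left, ← tsum_subtype _ fun a => (f a : ℝ≥0∞), ENNReal.toReal_mul,
    tsum_coe_eq_finsum hx, ENNReal.toReal_inv, inv_mul_eq_div, ← hx.cast_ncard_eq]
  simp

end RootDensity

section UniformRoot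

variable {Ω : Type*} [MeasurableSpace Ω] {S : Type u} {Ξ : Type w} {M : Type v} [Countable S]
  [MeasurableSpace S] [DiscreteMeasurableSpace S] [MeasurableSpace Ξ] {h : S × Ξ → S} {s : S}
  {P : Measure Ω} {ξ : ℤ → Ω → Ξ} {mV : S × Ξ → M} {mE : Bool → M}
  {I : Finset ℤ} {o : Ω → ℤ × S}

theorem measurable_rootDensity (hh : Measurable h) (a : ℤ × S) :
    Measurable (rootDensity h s I a : (ℤ → Ξ) → ℝ≥0∞) := by
  have h1 : Measurable fun x : ℤ → Ξ => ((windowVerts h s x I).encard : ℝ≥0∞) := by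
    have : (fun x : ℤ → Ξ => ((windowVerts h s x I).encard : ℝ≥0∞)) =
        fun x => ∑' a, {x | a ∈ windowVerts h s x I}.indicator (fun _ => 1) x := by
      funext x
      rw [← ENNReal.tsum_set_one, tsum_subtype _ fun _ => (1 : ℝ≥0∞)]
      rfl
    rw [this]
    exact Measurable.tsum fun a =>
      measurable_const.indicator (measurableSet_windowVerts s hh I a)
  exact h1.inv.indicator (measurableSet_windowVerts s hh I a)

variable [MetricSpace M] [TopologicalSpace.SeparableSpace M] [MeasurableSpace M] [BorelSpace M]

/-- A uniform root means that P restricted to `o = a` and P with density `rootDensity` agree on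
`windowSigma`. They therefore integrate the erased version of the class equally, and both ignore the
event that `a` is not in the window. -/
theorem lintegral_root_eq [IsFiniteMeasure P] (hh : Measurable h) (hmV : Measurable mV)
    (hξ : ∀ t, Measurable (ξ t)) (ho : IsUniformRoot P ξ h s mV mE I o)
    {g : GStar.{u} M → ℝ≥0} (hg : Measurable g) (a : ℤ × S) :
    ∫⁻ ω in o ⁻¹' {a}, g (windowClass h s mV mE (path ξ ω) I a) ∂P =
      ∫⁻ ω, rootDensity h s I a (path ξ ω) * g (windowClass h s mV mE (path ξ ω) I a) ∂P := by
  have hle : windowSigma ξ h s mV mE I ≤ ‹MeasurableSpace Ω› := windowSigma_le hh hmV hξ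
  have hφ : Measurable fun ω => rootDensity h s I a (path ξ ω) :=
    (measurable_rootDensity hh a).comp (measurable_path hξ)
  have htrim : (P.restrict (o ⁻¹' {a})).trim hle =
      (P.withDensity fun ω => rootDensity h s I a (path ξ ω)).trim hle := by
    refine @Measure.ext _ (windowSigma ξ h s mV mE I) _ _ fun E hE => ?_
    rw [trim_measurableSet_eq hle hE, trim_measurableSet_eq hle hE,
      Measure.restrict_apply (hle _ hE), withDensity_apply _ (hle _ hE), Set.inter_comm]
    exact ho.2 a E hE
  -- The defining identity of the root, applied to the event that `a` is absent, shows that `o = a`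
  -- has probability zero there.
  have hmem : ∀ᵐ ω ∂P.restrict (o ⁻¹' {a}), a ∈ windowVerts h s (path ξ ω) I := by
    have hE := (windowSigma_measurableSet_mem (ξ := ξ) (h := h) (s := s) (mV := mV) (mE := mE)
      (I := I) a).compl
    have h0 := ho.2 a _ hE
    rw [setLIntegral_congr_fun (g := fun _ => 0) (hle _ hE)
      fun ω (hω : a ∉ windowVerts h s (path ξ ω) I) => Set.indicator_of_notMem hω _] at h0
    have h1 : P.restrict (o ⁻¹' {a}) {ω | a ∈ windowVerts h s (path ξ ω) I}ᶜ = 0 := by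
      rw [Measure.restrict_apply (hle _ hE), Set.inter_comm, h0, lintegral_zero]
    exact h1
  have hY := hg.coe_nnreal_ennreal.comp (windowSigma_measurable_ofGraph (ξ := ξ) (h := h) (s := s)
    (mV := mV) (mE := mE) (I := I) (mE true) a)
  calc ∫⁻ ω in o ⁻¹' {a}, g (windowClass h s mV mE (path ξ ω) I a) ∂P
      = ∫⁻ ω in o ⁻¹' {a}, g (GStar.ofGraph (windowGraph h s (path ξ ω) I)
          (erasedMark h s mV (mE true) (path ξ ω) I) (edgeMark mE) a) ∂P := by
        refine lintegral_congr_ae ?_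
        filter_upwards [hmem] with ω hω
        rw [windowClass_eq_erasedMark (mE true) hω]
    _ = ∫⁻ ω, g (GStar.ofGraph (windowGraph h s (path ξ ω) I)
          (erasedMark h s mV (mE true) (path ξ ω) I) (edgeMark mE) a)
          ∂P.withDensity fun ω => rootDensity h s I a (path ξ ω) :=
        (lintegral_trim hle hY).symm.trans (htrim ▸ lintegral_trim hle hY)
    _ = ∫⁻ ω, rootDensity h s I a (path ξ ω) * g (GStar.ofGraph (windowGraph h s (path ξ ω) I)
          (erasedMark h s mV (mE true) (path ξ ω) I) (edgeMark mE) a) ∂P :=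
        lintegral_withDensity_eq_lintegral_mul _ hφ (hY.mono hle le_rfl)
    _ = _ := by
        refine lintegral_congr fun ω => ?_
        by_cases hω : a ∈ windowVerts h s (path ξ ω) I
        · rw [windowClass_eq_erasedMark (mE true) hω]
        · rw [rootDensity, Set.indicator_of_notMem hω, zero_mul, zero_mul]

theorem measurable_windowClass_root (hh : Measurable h) (hmV : Measurable mV)
    (hξ : ∀ t, Measurable (ξ t)) (ho : Measurable o) :
    Measurable fun ω => windowClass h s mV mE (path ξ ω) I (o ω) := by
  have : Measurable fun p : (ℤ × S) × Ω => windowClass h s mV mE (path ξ p.2) I p.1 :=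
    measurable_from_prod_countable_right fun a =>
      (measurable_windowClass s hh hmV mE I a).comp (measurable_path hξ)
  exact this.comp (ho.prodMk measurable_id)

theorem lintegral_windowClass_root [IsFiniteMeasure P] (hh : Measurable h) (hmV : Measurable mV)
    (hξ : ∀ t, Measurable (ξ t)) (ho : IsUniformRoot P ξ h s mV mE I o)
    {g : GStar.{u} M → ℝ≥0} (hg : Measurable g) :
    ∫⁻ ω, g (windowClass h s mV mE (path ξ ω) I (o ω)) ∂P =
      ∫⁻ ω, ∑' a, rootDensity h s I a (path ξ ω) * g (windowClass h s mV mE (path ξ ω) I a) ∂P := by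
  have hoa : ∀ a, MeasurableSet (o ⁻¹' {a}) := fun a => ho.1 (measurableSet_singleton a)
  have hm : ∀ a, Measurable fun ω =>
      rootDensity h s I a (path ξ ω) * (g (windowClass h s mV mE (path ξ ω) I a) : ℝ≥0∞) :=
    fun a => ((measurable_rootDensity hh a).comp (measurable_path hξ)).mul
      (hg.coe_nnreal_ennreal.comp
        ((measurable_windowClass s hh hmV mE I a).comp (measurable_path hξ)))
  rw [lintegral_tsum fun a => (hm a).aemeasurable]
  simp only [← lintegral_root_eq hh hmV hξ ho hg]
  rw [← setLIntegral_univ, show (Set.univ : Set Ω) = ⋃ a, o ⁻¹' {a} by ext; simp,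
    lintegral_iUnion hoa fun a b hab => Disjoint.preimage o (by simpa using hab)]
  refine tsum_congr fun a => setLIntegral_congr_fun (hoa a) fun ω hω => ?_
  rw [show o ω = a from hω]

/-- Turns the almost sure statement on averages into one on random roots. Measurability of the
average is obtained from its expression as a sum of densities. -/
theorem integral_windowClass_root [IsFiniteMeasure P] (hh : Measurable h) (hmV : Measurable mV)
    (hξ : ∀ t, Measurable (ξ t)) (hfin : ∀ᵐ ω ∂P, (windowVerts h s (path ξ ω) I).Finite)
    (ho : IsUniformRoot P ξ h s mV mE I o) {g : GStar.{u} M → ℝ≥0} (hg : Measurable g) {C : ℝ≥0}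
    (hC : ∀ y, g y ≤ C) :
    AEStronglyMeasurable (fun ω => (∑ᶠ a ∈ windowVerts h s (path ξ ω) I,
        (g (windowClass h s mV mE (path ξ ω) I a) : ℝ)) /
      ((windowVerts h s (path ξ ω) I).ncard : ℝ)) P ∧
    ∫ ω, (g (windowClass h s mV mE (path ξ ω) I (o ω)) : ℝ) ∂P =
      ∫ ω, (∑ᶠ a ∈ windowVerts h s (path ξ ω) I,
        (g (windowClass h s mV mE (path ξ ω) I a) : ℝ)) /
      ((windowVerts h s (path ξ ω) I).ncard : ℝ) ∂P := by
  have hm : Measurable fun ω => ∑' a, rootDensity h s I a (path ξ ω) *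
      (g (windowClass h s mV mE (path ξ ω) I a) : ℝ≥0∞) :=
    Measurable.tsum fun a => ((measurable_rootDensity hh a).comp (measurable_path hξ)).mul
      (hg.coe_nnreal_ennreal.comp
        ((measurable_windowClass s hh hmV mE I a).comp (measurable_path hξ)))
  have heq : (fun ω => (∑' a, rootDensity h s I a (path ξ ω) *
      (g (windowClass h s mV mE (path ξ ω) I a) : ℝ≥0∞)).toReal) =ᵐ[P]
      fun ω => (∑ᶠ a ∈ windowVerts h s (path ξ ω) I,
        (g (windowClass h s mV mE (path ξ ω) I a) : ℝ)) /
      ((windowVerts h s (path ξ ω) I).ncard : ℝ) := by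
    filter_upwards [hfin] with ω hω
    exact tsum_rootDensity_eq hω fun a => g (windowClass h s mV mE (path ξ ω) I a)
  refine ⟨hm.ennreal_toReal.aestronglyMeasurable.congr heq, ?_⟩
  have hlt : ∫⁻ ω, g (windowClass h s mV mE (path ξ ω) I (o ω)) ∂P < ∞ := by
    refine (lintegral_mono (g := fun _ => (C : ℝ≥0∞)) fun ω =>
      ENNReal.coe_le_coe.2 (hC _)).trans_lt ?_
    rw [lintegral_const]
    exact ENNReal.mul_lt_top ENNReal.coe_lt_top (measure_lt_top _ _)
  have hreal : Measurable fun ω => (g (windowClass h s mV mE (path ξ ω) I (o ω)) : ℝ) :=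
    measurable_coe_nnreal_real.comp (hg.comp (measurable_windowClass_root hh hmV hξ ho.1))
  have hsum := lintegral_windowClass_root hh hmV hξ ho hg
  rw [← integral_congr_ae heq, integral_toReal hm.aemeasurable
    (ae_lt_top hm (hsum ▸ hlt.ne)), ← hsum, integral_eq_lintegral_of_nonneg_ae
    (ae_of_all _ fun ω => NNReal.coe_nonneg _) hreal.aestronglyMeasurable]
  simp only [ENNReal.ofReal_coe_nnreal]

theorem tendsto_integral_windowClass_root [IsProbabilityMeasure P] (hh : Measurable h)
    (hmV : Measurable mV) (hξ : ∀ t, Measurable (ξ t)) (hξerg : IsStationaryErgodic P ξ)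
    (hs : IsPositiveRecurrent P ξ h s) {I : ℕ → Finset ℤ}
    (hI : ∀ n, (I n : Set ℤ).OrdConnected) (hmono : StrictMono I) {o : ℕ → Ω → ℤ × S}
    (ho : ∀ n, IsUniformRoot P ξ h s mV mE (I n) (o n)) {g : GStar.{u} M → ℝ≥0}
    (hgm : Measurable g) {C : ℝ≥0} (hC : ∀ y, g y ≤ C) (hg : IsAlmostLocal g) :
    Tendsto (fun n => ∫ ω, (g (windowClass h s mV mE (path ξ ω) (I n) (o n ω)) : ℝ) ∂P) atTop
      (𝓝 (∫ y, (g y : ℝ) ∂unimodularMeasure P ξ h s mV mE)) := by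
  have hx := ae_finite_windowVerts_path hh hξ hξerg hs
  have hfin : ∀ n, ∀ᵐ ω ∂P, (windowVerts h s (path ξ ω) (I n)).Finite := fun n => by
    filter_upwards [hx] with ω hω
    exact finite_windowVerts hω (I n)
  have key := fun n => integral_windowClass_root hh hmV hξ (hfin n) (ho n) hgm hC
  simp only [fun n => (key n).2]
  have hlim := tendsto_integral_of_dominated_convergence (fun _ => (C : ℝ)) (fun n => (key n).1)
    (integrable_const _) ?_ (ae_tendsto_average hh hmV mE hξ hξerg hs hI hmono hgm hC hg)
  · simpa using hlim
  · intro n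
    filter_upwards [hfin n] with ω hω
    rw [Real.norm_eq_abs, abs_of_nonneg (div_nonneg
      (finsum_nonneg fun _ => finsum_nonneg fun _ => NNReal.coe_nonneg _) (Nat.cast_nonneg _))]
    refine div_le_of_le_mul₀ (Nat.cast_nonneg _) C.coe_nonneg ?_
    rw [finsum_mem_eq_finite_toFinset_sum _ hω, Set.ncard_eq_toFinset_card _ hω, mul_comm,
      ← nsmul_eq_mul]
    exact Finset.sum_le_card_nsmul _ _ _ fun a _ => by exact_mod_cast hC _

theorem isAlmostLocal_of_isLocal {M : Type v} {g : GStar.{u} M → ℝ≥0} (hg : GStar.IsLocal g) :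
    IsAlmostLocal g := by
  obtain ⟨N, hN⟩ := hg
  exact fun ε hε => ⟨N, fun y z hyz => by rw [hN y z hyz, sub_self, abs_zero]; exact hε.le⟩

/-- Coinciding balls of radius `N + 1` give distance at most 1/(N + 2), hence values differing by at
most L/(N + 2). -/
theorem isAlmostLocal_of_lipschitz {M : Type v} [MetricSpace M] {g : GStar.{u} M → ℝ≥0}
    {L : ℝ≥0} (hg : ∀ y z, |(g y : ℝ) - g z| ≤ L * dist y z) : IsAlmostLocal g := by
  intro ε hε
  obtain ⟨N, hN⟩ := exists_nat_gt (L / ε)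
  refine ⟨N + 1, fun y z hyz => (hg y z).trans ?_⟩
  have h1 := GStar.netDist_le_of_ballIso_eq (Nat.succ_pos N) hyz
  rw [GStar.dist_eq_netDist]
  refine (mul_le_mul_of_nonneg_left h1 L.coe_nonneg).trans ?_
  rw [div_lt_iff₀ hε] at hN
  rw [mul_one_div, div_le_iff₀ (by positivity)]
  push_cast
  nlinarith

theorem localWeakTendsto_windowClass [IsProbabilityMeasure P] (hh : Measurable h)
    (hmV : Measurable mV) (hξ : ∀ t, Measurable (ξ t)) (hξerg : IsStationaryErgodic P ξ)
    (hs : IsPositiveRecurrent P ξ h s) {I : ℕ → Finset ℤ}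
    (hI : ∀ n, (I n : Set ℤ).OrdConnected) (hmono : StrictMono I) {o : ℕ → Ω → ℤ × S}
    (ho : ∀ n, IsUniformRoot P ξ h s mV mE (I n) (o n)) :
    LocalWeakTendsto P (fun n ω => windowClass h s mV mE (path ξ ω) (I n) (o n ω))
      (unimodularMeasure P ξ h s mV mE) := by
  have hX : ∀ n, Measurable fun ω => windowClass h s mV mE (path ξ ω) (I n) (o n ω) := fun n =>
    measurable_windowClass_root hh hmV hξ (ho n).1
  have hU := isProbabilityMeasure_unimodularMeasure s mE hh hmV hξ hξerg hs
  refine ⟨fun n => (hX n).aemeasurable,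
    fun n => Measure.isProbabilityMeasure_map (hX n).aemeasurable, hU, ?_⟩
  refine tendsto_iff_forall_lipschitz_integral_tendsto.2 ?_
  rintro f ⟨C, hC⟩ ⟨L, hL⟩
  obtain ⟨ω₀⟩ := nonempty_of_isProbabilityMeasure P
  set y₀ := bridgeClass h s mV mE (path ξ ω₀) (0, s)
  have hC' : ∀ y, |f y - f y₀| ≤ C := fun y => hC y y₀
  -- The averages are treated for nonnegative functions. Since `f` oscillates by at most `C`, this
  -- translate takes values in [0, 2C], and the constant is restored afterwards.
  set g : GStar.{u} M → ℝ≥0 := fun y => (f y - f y₀ + C).toNNReal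
  have hgf : ∀ y, (g y : ℝ) = f y - f y₀ + C := fun y =>
    Real.coe_toNNReal _ (by linarith [(abs_le.1 (hC' y)).1])
  have hgm : Measurable g :=
    ((hL.continuous.measurable.sub_const _).add_const _).real_toNNReal
  have hgC : ∀ y, g y ≤ (2 * C).toNNReal := fun y =>
    Real.toNNReal_le_toNNReal (by linarith [(abs_le.1 (hC' y)).2])
  have hgl : IsAlmostLocal g := isAlmostLocal_of_lipschitz (L := L) fun y z => by
    rw [hgf, hgf, add_sub_add_right_eq_sub, sub_sub_sub_cancel_right]
    exact hL.dist_le_mul y z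
  have hf : f = fun y => (g y : ℝ) + (f y₀ - C) := funext fun y => by rw [hgf]; ring
  have hint : ∀ (ν : Measure (GStar.{u} M)) [IsProbabilityMeasure ν],
      ∫ y, f y ∂ν = ∫ y, (g y : ℝ) ∂ν + (f y₀ - C) := fun ν _ => by
    have hgi : Integrable (fun y => (g y : ℝ)) ν :=
      Integrable.of_bound (measurable_coe_nnreal_real.comp hgm).aestronglyMeasurable
        ((2 * C).toNNReal : ℝ) (ae_of_all _ fun y => by
          rw [Real.norm_eq_abs, abs_of_nonneg (NNReal.coe_nonneg _)]
          exact_mod_cast hgC y)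
    conv_lhs => rw [hf]
    rw [integral_add hgi (integrable_const _)]
    simp
  have hmap : ∀ n, IsProbabilityMeasure
      (P.map fun ω => windowClass h s mV mE (path ξ ω) (I n) (o n ω)) := fun n =>
    Measure.isProbabilityMeasure_map (hX n).aemeasurable
  have hlim := (tendsto_integral_windowClass_root hh hmV hξ hξerg hs hI hmono ho hgm hgC
    hgl).add_const (f y₀ - C)
  rw [← hint] at hlim
  refine hlim.congr fun n => ?_
  change _ = ∫ y, f y ∂(P.map fun ω => windowClass h s mV mE (path ξ ω) (I n) (o n ω))
  have hgr : Measurable fun y => (g y : ℝ) := measurable_coe_nnreal_real.comp hgm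
  rw [hint, integral_map (hX n).aemeasurable hgr.aestronglyMeasurable]

end UniformRoot

end Doeblin

theorem mainTheorem9
    {Ω : Type*} [MeasurableSpace Ω] (P : Measure Ω) [IsProbabilityMeasure P]
    {S : Type*} [Countable S] [TopologicalSpace S] [DiscreteTopology S]
    [MeasurableSpace S] [DiscreteMeasurableSpace S]
    {Ξ : Type*} [MetricSpace Ξ] [CompleteSpace Ξ] [TopologicalSpace.SeparableSpace Ξ]
    [MeasurableSpace Ξ] [BorelSpace Ξ]
    {M : Type*} [MetricSpace M] [CompleteSpace M] [TopologicalSpace.SeparableSpace M]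
    [MeasurableSpace M] [BorelSpace M]
    (mV : S × Ξ → M) (hmV : IsEmbedding mV) (mE : Bool → M) (hmE : Function.Injective mE)
    (h : S × Ξ → S) (hh : Measurable h)
    (ξ : ℤ → Ω → Ξ) (hξ : ∀ t, Measurable (ξ t)) (hξerg : Doeblin.IsStationaryErgodic P ξ)
    (s : S) (hs : Doeblin.IsPositiveRecurrent P ξ h s)
    (I : ℕ → Finset ℤ) (hI : ∀ n, (I n : Set ℤ).OrdConnected) (hImono : StrictMono I) :
    IsProbabilityMeasure (Doeblin.unimodularMeasure P ξ h s mV mE) ∧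
    (∀ᵐ ω ∂P, ∀ n, (Doeblin.windowVerts h s (Doeblin.path ξ ω) (I n)).Finite) ∧
    (∀ g : Doeblin.GStar M → ℝ≥0, Measurable g → (∃ C, ∀ x, g x ≤ C) → Doeblin.GStar.IsLocal g →
      ∀ᵐ ω ∂P, Tendsto
        (fun n =>
          (∑ᶠ a ∈ Doeblin.windowVerts h s (Doeblin.path ξ ω) (I n),
            (g (Doeblin.windowClass h s mV mE (Doeblin.path ξ ω) (I n) a) : ℝ)) /
          ((Doeblin.windowVerts h s (Doeblin.path ξ ω) (I n)).ncard : ℝ))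
        atTop (𝓝 (∫ x, (g x : ℝ) ∂(Doeblin.unimodularMeasure P ξ h s mV mE)))) ∧
    (∀ o : ℕ → Ω → ℤ × S, (∀ n, Doeblin.IsUniformRoot P ξ h s mV mE (I n) (o n)) →
      Doeblin.LocalWeakTendsto P
        (fun n ω => Doeblin.windowClass h s mV mE (Doeblin.path ξ ω) (I n) (o n ω))
        (Doeblin.unimodularMeasure P ξ h s mV mE)) := by
  -- As `S` is countable and discrete, measurability on the product may be checked for each state
  -- separately, where continuity of the embedding gives it.
  have hmVm : Measurable mV :=
    measurable_from_prod_countable_right fun y =>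
      (hmV.continuous.comp (Continuous.prodMk_right y)).measurable
  refine ⟨Doeblin.isProbabilityMeasure_unimodularMeasure s mE hh hmVm hξ hξerg hs, ?_, ?_, ?_⟩
  · filter_upwards [Doeblin.ae_finite_windowVerts_path hh hξ hξerg hs] with ω hω n
    exact Doeblin.finite_windowVerts hω (I n)
  · rintro g hg ⟨C, hC⟩ hloc
    exact Doeblin.ae_tendsto_average hh hmVm mE hξ hξerg hs hI hImono hg hC
      (Doeblin.isAlmostLocal_of_isLocal hloc)
  · intro o ho
    exact Doeblin.localWeakTendsto_windowClass hh hmVm hξ hξerg hs hI hImono ho
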